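/- Let $P\subset\mathbb R^n$ be an $n$-dimensional convex polytope, and let its set of normals $N(P)$ be the set of outer unit normal vectors of its facets. Suppose that $P$ is strongly monotypic, i.e. for every $n$-dimensional polytope $Q\subset\mathbb R^n$ with $N(Q)=N(P)$, the arrangement of the hyperplanes containing the facets of $Q$ is combinatorially equivalent to the arrangement of the hyperplanes containing the facets of $P$ (there is a bijection between the cells, of all dimensions, of the two arrangements that preserves in both directions the relation "is contained in the closure of"). Call pairwise disjoint finite sets $X_1,\dots,X_k\subseteq N(P)$ a skeleton of $P$ if (i) each $X_i$ is the set of vertices of a simplex whose relative interior contains $0$, (ii) the linear spans of $X_1,\dots,X_k$ are linearly independent, and (iii) these linear spans directly sum up to $\mathbb R^n$. Then: (a) $P$ has a skeleton. (b) For every skeleton $X_1,\dots,X_k$ of $P$ there is a set $V$ of exactly $|X_1|\cdots|X_k|$ vectors such that for every point $x$ on the boundary of $P$ there is $v\in V$ with $x-v$ in the interior of $P$; moreover $|X_1|\cdots|X_k|\le 2^n$. (c) Consequently Boltyanski's illumination conjecture holds for $P$: there is a set $V$ of at most $2^n$ vectors such that for every point $x$ on the boundary of $P$ there is $v\in V$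 with $x-v$ in the interior of $P$. The equivalent conjecture of Hadwiger also holds for $P$: for some $0<\varepsilon<1$, $P$ can be covered by at most $2^n$ translates of $(1-\varepsilon)P$. -/

import Mathlib

/-- A full-dimensional (that is, `n`-dimensional) convex polytope in `ℝⁿ`: the convex hull of
finitely many points, with non-empty interior. -/
def IsFullPolytope {n : ℕ} (P : Set (EuclideanSpace ℝ (Fin n))) : Prop :=
  (∃ s : Finset (EuclideanSpace ℝ (Fin n)), P = convexHull ℝ (s : Set (EuclideanSpace ℝ (Fin n)))) ∧
    (interior P).Nonempty

/-- The support function `h_P(u) = sup_{p ∈ P} ⟨u, p⟩`. -/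
noncomputable def supportFn {n : ℕ} (P : Set (EuclideanSpace ℝ (Fin n)))
    (u : EuclideanSpace ℝ (Fin n)) : ℝ :=
  sSup ((fun p => inner ℝ u p) '' P)

/-- The face of `P` on which the linear functional `⟨u, ·⟩` attains its maximum over `P`. -/
def faceIn {n : ℕ} (P : Set (EuclideanSpace ℝ (Fin n))) (u : EuclideanSpace ℝ (Fin n)) :
    Set (EuclideanSpace ℝ (Fin n)) :=
  {x | x ∈ P ∧ ∀ y ∈ P, inner ℝ u y ≤ inner ℝ u x}

/-- The set `N(P)` of normals of `P`: the outer unit normal vectors of the facets of `P`, a facet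
being a face of dimension `n - 1`. -/
def facetNormals {n : ℕ} (P : Set (EuclideanSpace ℝ (Fin n))) :
    Set (EuclideanSpace ℝ (Fin n)) :=
  {u | ‖u‖ = 1 ∧ (faceIn P u).Nonempty ∧ Module.finrank ℝ (vectorSpan ℝ (faceIn P u)) + 1 = n}

/-- The position of a point `x` relative to the arrangement of the facet hyperplanes
`{y | ⟨u, y⟩ = h_P(u)}`, `u ∈ N(P)`: for each hyperplane, on which side of it `x` lies, or `0` if
`x` lies on it. -/
noncomputable def positionVector {n : ℕ} (P : Set (EuclideanSpace ℝ (Fin n)))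
    (x : EuclideanSpace ℝ (Fin n)) : facetNormals P → SignType :=
  fun u => SignType.sign (inner ℝ (u : EuclideanSpace ℝ (Fin n)) x - supportFn P u)

/-- The (relatively open) cells, of all dimensions, into which the facet hyperplanes of `P`
decompose `ℝⁿ`. A cell consists of all the points with the same position vector, and it is
represented here by that vector. -/
def ArrangementCell {n : ℕ} (P : Set (EuclideanSpace ℝ (Fin n))) : Type :=
  Set.range (positionVector P)

/-- The face relation between cells: `F` is contained in the closure of `G`. In terms of position
vectors, `F` is obtained from `G` by replacing some of the signs by `0`. -/
def ArrangementCell.IsFaceOf {n : ℕ} {P : Set (EuclideanSpace ℝ (Fin n))}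
    (F G : ArrangementCell P) : Prop :=
  ∀ u : facetNormals P, F.1 u = 0 ∨ F.1 u = G.1 u

/-- The arrangements of the hyperplanes containing the facets of `P` and of `Q` are combinatorially
equivalent: there is a bijection between their cells that preserves the face relation in both
directions. -/
def ArrangementsEquivalent {n : ℕ} (P Q : Set (EuclideanSpace ℝ (Fin n))) : Prop :=
  ∃ e : ArrangementCell P ≃ ArrangementCell Q,
    ∀ F G : ArrangementCell P, (e F).IsFaceOf (e G) ↔ F.IsFaceOf G

/-- Strongly monotypic polytopes: every polytope with the same set of normals has a combinatorially
equivalent arrangement of facet hyperplanes. -/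
def IsStronglyMonotypic {n : ℕ} (P : Set (EuclideanSpace ℝ (Fin n))) : Prop :=
  IsFullPolytope P ∧
    ∀ Q : Set (EuclideanSpace ℝ (Fin n)), IsFullPolytope Q → facetNormals Q = facetNormals P →
      ArrangementsEquivalent P Q

/-- `X 0, …, X (k - 1)` are disjoint sets of normals of `P` such that each `X i` is the vertex set
of a simplex with `0` in its relative interior, and `ℝⁿ` is the direct sum of the linear spans of
the `X i`. -/
structure IsSkeleton {n : ℕ} (P : Set (EuclideanSpace ℝ (Fin n))) {k : ℕ}
    (X : Fin k → Finset (EuclideanSpace ℝ (Fin n))) : Prop where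
  subset_normals : ∀ i, ∀ u ∈ X i, u ∈ facetNormals P
  disjoint : ∀ i j, i ≠ j → Disjoint (X i) (X j)
  simplex : ∀ i, AffineIndependent ℝ (fun u : X i => (u : EuclideanSpace ℝ (Fin n)))
  zero_mem : ∀ i,
    (0 : EuclideanSpace ℝ (Fin n)) ∈
      intrinsicInterior ℝ (convexHull ℝ (X i : Set (EuclideanSpace ℝ (Fin n))))
  independent : iSupIndep
    (fun i => Submodule.span ℝ (X i : Set (EuclideanSpace ℝ (Fin n))))
  span_eq_top : ⨆ i, Submodule.span ℝ (X i : Set (EuclideanSpace ℝ (Fin n))) = ⊤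

/-- The finite set `V` of vectors illuminates `C`: every boundary point `x` of `C` has some `v ∈ V`
with `x - v` in the interior of `C`. -/
def Illuminates {n : ℕ} (V : Finset (EuclideanSpace ℝ (Fin n)))
    (C : Set (EuclideanSpace ℝ (Fin n))) : Prop :=
  ∀ x ∈ frontier C, ∃ v ∈ V, x - v ∈ interior C

/-- The assertion of Boltyanski's illumination conjecture for `C ⊆ ℝⁿ`. -/
def SatisfiesBoltyanski {n : ℕ} (C : Set (EuclideanSpace ℝ (Fin n))) : Prop :=
  ∃ V : Finset (EuclideanSpace ℝ (Fin n)), V.card ≤ 2 ^ n ∧ Illuminates V C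

/-- The assertion of Hadwiger's covering conjecture for `C ⊆ ℝⁿ`: for some `0 < ε < 1`, at most
`2 ^ n` translates `t + (1 - ε) C` cover `C`. -/
def SatisfiesHadwiger {n : ℕ} (C : Set (EuclideanSpace ℝ (Fin n))) : Prop :=
  ∃ ε : ℝ, 0 < ε ∧ ε < 1 ∧
    ∃ T : Finset (EuclideanSpace ℝ (Fin n)), T.card ≤ 2 ^ n ∧
      ∀ x ∈ C, ∃ t ∈ T, ∃ y ∈ C, x = t + (1 - ε) • y

/-! The whole argument rests on the signs of the circuits of `N(P)`, its minimal linear relations `∑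
c u • u = 0`. The facet hyperplanes whose normals form the support of a circuit `c` have a common
point exactly when `∑ c u * h_P(u) = 0`.

Strong monotypy forbids this (`IsStronglyMonotypic.sum_mul_supportFn_ne_zero`). Adding a short
segment to `P` while keeping only its normals changes `h_P(u)` by `max ⟨u, y⟩ 0`. For suitable `y`
this makes the sum positive: no chamber of the arrangement is lost and a new one opens, although
equivalent arrangements have equally many chambers. If a circuit had two positive and two negative
coefficients, longer segments could push the sum in either direction until it vanished for a
polytope with the same normals. Hence every circuit has at most one positive or at most one negative
coefficient (`IsStronglyMonotypic.circuit_signs`).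

Skeleton: families of independent simplices around `0` are enlarged until they span
(`IsBlockFamily.exists_span_lt`). Modulo the current span `L`, the normals outside `L` have a
positive circuit `d`. Its sum lies in `L` and is a nonnegative combination `γ` of the family that
omits a vector of each block. Then `d - γ` is a circuit with at least two positive coefficients, so
`γ` has at most one term. If it has none, the support of `d` is a new block; if its term is at `x`,
the support of `d` replaces `x` in its block.

Illumination: omitting one vector of each block leaves a basis, and the direction for this choice
has inner product `1` with each basis vector. At `x ∈ P` the sum of the active normals is a
nonnegative combination of such a basis. The sign condition and the independence of active normals
put each active normal in the cone of the basis vectors used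
(`IsStronglyMonotypic.active_mem_cone`), so the direction has positive product with all of them.
Compactness gives one common scaling, and the count follows from `m ≤ 2 ^ (m - 1)`. -/

/-- The coefficients `c`, zero off `N`, form a linear relation between the vectors `v i`, `i ∈ N`. -/
structure IsRelation {ι M : Type*} [AddCommGroup M] [Module ℝ M] (v : ι → M) (N : Finset ι)
    (c : ι → ℝ) : Prop where
  supp : ∀ i, i ∉ N → c i = 0
  sum_eq : ∑ i ∈ N, c i • v i = 0

/-- A nonzero linear relation of minimal support. -/
structure IsCircuit {ι M : Type*} [AddCommGroup M] [Module ℝ M] (v : ι → M) (N : Finset ι)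
    (c : ι → ℝ) : Prop extends IsRelation v N c where
  ne_zero : ∃ i, c i ≠ 0
  eq_smul : ∀ d, IsRelation v N d → (∀ i, c i = 0 → d i = 0) → ∃ t : ℝ, ∀ i, d i = t * c i

/-- Every sign of `d` agrees with the sign of `c`, or is zero. -/
def SignConformal {ι : Type*} (d c : ι → ℝ) : Prop :=
  ∀ i, (0 < d i → 0 < c i) ∧ (d i < 0 → c i < 0)

theorem SignConformal.refl {ι : Type*} (c : ι → ℝ) : SignConformal c c := fun _ => ⟨id, id⟩

theorem SignConformal.trans {ι : Type*} {a b c : ι → ℝ} (h : SignConformal a b) (h' : SignConformal b c) :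
    SignConformal a c := fun i => ⟨(h' i).1 ∘ (h i).1, (h' i).2 ∘ (h i).2⟩

theorem SignConformal.eq_zero {ι : Type*} {d c : ι → ℝ} (h : SignConformal d c) {i : ι} (hi : c i = 0) :
    d i = 0 := by
  rcases lt_trichotomy (d i) 0 with h1 | h1 | h1
  · exact absurd ((h i).2 h1) (by simp [hi])
  · exact h1
  · exact absurd ((h i).1 h1) (by simp [hi])

/-! ### Linear relations and conformal circuits -/

section Relation

variable {ι M : Type*} [AddCommGroup M] [Module ℝ M] {v : ι → M} {N : Finset ι}

theorem IsRelation.mem {c : ι → ℝ} (h : IsRelation v N c) {i : ι} (hi : c i ≠ 0) : i ∈ N := by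
  by_contra h'
  exact hi (h.supp i h')

theorem IsRelation.sub_mul {c d : ι → ℝ} (hc : IsRelation v N c) (hd : IsRelation v N d) (t : ℝ) :
    IsRelation v N (fun i => c i - t * d i) where
  supp i hi := by simp [hc.supp i hi, hd.supp i hi]
  sum_eq := by
    simp only [sub_smul, Finset.sum_sub_distrib, mul_smul, ← Finset.smul_sum, hc.sum_eq, hd.sum_eq]
    simp

theorem IsRelation.neg {c : ι → ℝ} (hc : IsRelation v N c) : IsRelation v N (fun i => -c i) where
  supp i hi := by simp [hc.supp i hi]
  sum_eq := by simp [hc.sum_eq]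

theorem IsCircuit.neg {c : ι → ℝ} (hc : IsCircuit v N c) : IsCircuit v N (fun i => -c i) where
  toIsRelation := hc.toIsRelation.neg
  ne_zero := by simpa using hc.ne_zero
  eq_smul d hd h := by
    obtain ⟨t, ht⟩ := hc.eq_smul d hd (fun i hi => h i (by simp [hi]))
    exact ⟨-t, fun i => by simp [ht]⟩

theorem IsRelation.mono {c : ι → ℝ} {N' : Finset ι} (hc : IsRelation v N c) (h : N ⊆ N') :
    IsRelation v N' c where
  supp i hi := hc.supp i (fun h' => hi (h h'))
  sum_eq := by
    rw [← Finset.sum_subset h (fun i _ hi => by rw [hc.supp i hi, zero_smul]), hc.sum_eq]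

theorem IsRelation.of_supp {c : ι → ℝ} {N' : Finset ι} (hc : IsRelation v N' c) (h : N ⊆ N')
    (hN : ∀ i, i ∉ N → c i = 0) : IsRelation v N c where
  supp := hN
  sum_eq := by
    rw [Finset.sum_subset h (fun i _ hi => by rw [hN i hi, zero_smul]), hc.sum_eq]

/-- If `c` is not minimal, some relation inside its support is not proportional to it. Subtracting a
multiple of that relation kills a coefficient of `c` without reversing any sign or touching `e`;
induction on the size of the support finishes. -/
theorem IsRelation.exists_conformal_circuit {c : ι → ℝ} (hc : IsRelation v N c) {e : ι}
    (he : c e ≠ 0) : ∃ d, IsCircuit v N d ∧ SignConformal d c ∧ d e ≠ 0 := by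
  classical
  induction hk : (N.filter (fun i => c i ≠ 0)).card using Nat.strong_induction_on
    generalizing c with
  | _ k ih =>
  by_cases h : ∀ d, IsRelation v N d → (∀ i, c i = 0 → d i = 0) → ∃ t : ℝ, ∀ i, d i = t * c i
  · exact ⟨c, ⟨hc, ⟨e, he⟩, h⟩, SignConformal.refl c, he⟩
  push Not at h
  obtain ⟨d₀, hd₀, hsupp₀, hne₀⟩ := h
  obtain ⟨j₀, hj₀⟩ := hne₀ (d₀ e / c e)
  -- Normalized to vanish at `e`, so that subtracting multiples of `d` keeps `c e`.
  set d : ι → ℝ := fun i => d₀ i - d₀ e / c e * c i with hd_def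
  have hd : IsRelation v N d := hd₀.sub_mul hc _
  have hsupp : ∀ i, c i = 0 → d i = 0 := fun i hi => by simp [hd_def, hi, hsupp₀ i hi]
  have hde : d e = 0 := by simp [hd_def, he]
  have hdj : d j₀ ≠ 0 := sub_ne_zero.2 hj₀
  -- The index with the smallest ratio is the first coefficient to reach zero.
  obtain ⟨i, hi, hmin⟩ := Finset.exists_min_image (N.filter (fun i => d i ≠ 0))
    (fun i => |c i| / |d i|) ⟨j₀, Finset.mem_filter.2 ⟨hd.mem hdj, hdj⟩⟩
  have hdi : d i ≠ 0 := (Finset.mem_filter.1 hi).2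
  have hci : c i ≠ 0 := fun h => hdi (hsupp i h)
  set c' : ι → ℝ := fun j => c j - c i / d i * d j with hc'_def
  have hc' : IsRelation v N c' := hc.sub_mul hd _
  have hbound : ∀ j, |c i / d i * d j| ≤ |c j| := by
    intro j
    by_cases hj : d j = 0
    · simp [hj]
    · have := hmin j (Finset.mem_filter.2 ⟨hd.mem hj, hj⟩)
      rw [abs_mul, abs_div]
      rwa [le_div_iff₀ (abs_pos.2 hj)] at this
  have hconf : SignConformal c' c := by
    intro j
    have hb := hbound j
    constructor
    · intro hj
      by_contra hneg
      rw [abs_of_nonpos (not_lt.1 hneg)] at hb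
      have := (abs_le.1 hb).1
      simp only [hc'_def] at hj
      linarith
    · intro hj
      by_contra hneg
      rw [abs_of_nonneg (not_lt.1 hneg)] at hb
      have := (abs_le.1 hb).2
      simp only [hc'_def] at hj
      linarith
  have hc'e : c' e ≠ 0 := by simpa [hc'_def, hde] using he
  have hc'i : c' i = 0 := by simp [hc'_def, hdi]
  have hlt : (N.filter (fun i => c' i ≠ 0)).card < k := by
    rw [← hk]
    apply Finset.card_lt_card
    refine Finset.ssubset_iff_subset_ne.2 ⟨fun j hj => ?_, fun heq => ?_⟩
    · rw [Finset.mem_filter] at hj ⊢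
      exact ⟨hj.1, fun h => hj.2 (hconf.eq_zero h)⟩
    · have : i ∈ N.filter (fun i => c i ≠ 0) := Finset.mem_filter.2 ⟨hc.mem hci, hci⟩
      rw [← heq] at this
      exact (Finset.mem_filter.1 this).2 hc'i
  obtain ⟨b, hb, hbc, hbe⟩ := ih _ hlt hc' hc'e rfl
  exact ⟨b, hb, hbc.trans hconf, hbe⟩

end Relation

/-! ### Circuits of vectors in an inner product space -/

section InnerRelation

variable {E : Type*} [NormedAddCommGroup E] [InnerProductSpace ℝ E] {N : Finset E}

theorem IsRelation.sum_inner {c : E → ℝ} (hc : IsRelation id N c) (x : E) :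
    ∑ u ∈ N, c u * inner ℝ u x = 0 := by
  have := congrArg (fun w => inner ℝ w x) hc.sum_eq
  simpa [_root_.sum_inner, real_inner_smul_left] using this

/-- Otherwise `c` has at most one coefficient of each sign. The relation then says that a unit
vector is zero, or that two distinct unit vectors are positive multiples of each other. -/
theorem IsCircuit.exists_ne_mul_pos {c : E → ℝ} (hc : IsCircuit id N c)
    (hN : ∀ u ∈ N, ‖u‖ = 1) : ∃ u v, u ≠ v ∧ 0 < c u * c v := by
  classical
  by_contra! h
  obtain ⟨e, he⟩ := hc.ne_zero
  have heN := hc.mem he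
  by_cases h2 : ∃ f, f ≠ e ∧ c f ≠ 0
  · obtain ⟨f, hfe, hf⟩ := h2
    have hfN := hc.mem hf
    have hef : c e * c f < 0 := lt_of_le_of_ne (h e f hfe.symm) (mul_ne_zero he hf)
    have hz : ∀ w, w ≠ e → w ≠ f → c w = 0 := by
      intro w hwe hwf
      by_contra hw
      have h1 := lt_of_le_of_ne (h w e hwe) (mul_ne_zero hw he)
      have h2 := lt_of_le_of_ne (h w f hwf) (mul_ne_zero hw hf)
      have : 0 < (c w * c e) * (c w * c f) := mul_pos_of_neg_of_neg h1 h2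
      nlinarith [mul_self_nonneg (c w)]
    have hs := hc.sum_eq
    rw [← Finset.add_sum_erase _ _ heN,
      ← Finset.add_sum_erase (a := f) _ _ (by simp [hfe, hfN]), Finset.sum_eq_zero, add_zero] at hs
    · have h3 : c e • e = -(c f • f) := eq_neg_of_add_eq_zero_left hs
      have h4 := congrArg norm h3
      rw [norm_neg, norm_smul, norm_smul, hN e heN, hN f hfN, mul_one, mul_one, Real.norm_eq_abs,
        Real.norm_eq_abs] at h4
      have h5 : c e = -c f := by
        rcases abs_eq_abs.1 h4 with h5 | h5
        · rw [h5] at hef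
          nlinarith [mul_self_nonneg (c f)]
        · exact h5
      rw [h5, neg_smul, neg_inj] at h3
      exact hfe (smul_right_injective E hf h3).symm
    · intro w hw
      simp only [Finset.mem_erase] at hw
      simp [hz w hw.2.1 hw.1]
  · push Not at h2
    have hs := hc.sum_eq
    rw [Finset.sum_eq_single e (fun w _ hw => by simp [h2 w hw]) (fun h => absurd heN h)] at hs
    have h4 := congrArg norm hs
    simp [norm_smul, hN e heN, he] at h4

theorem linearIndependent_of_relation_eq_zero {S : Finset E}
    (h : ∀ c, IsRelation id S c → ∀ u, c u = 0) :
    LinearIndependent ℝ (fun u : S => (u : E)) := by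
  classical
  rw [Fintype.linearIndependent_iff]
  intro g hg i
  have := h (fun u => if hu : u ∈ S then g ⟨u, hu⟩ else 0) ⟨fun i hi => by simp [hi], ?_⟩ i
  · simpa using this
  · rw [← hg, ← Finset.sum_coe_sort]
    simp

variable [FiniteDimensional ℝ E]

theorem LinearIndependent.exists_inner_eq {ι : Type*} {v : ι → E} (hv : LinearIndependent ℝ v)
    (t : ι → ℝ) : ∃ x : E, ∀ i, inner ℝ (v i) x = t i := by
  obtain ⟨g, hg⟩ := LinearMap.exists_extend ((Module.Basis.span hv).constr ℝ t)
  refine ⟨(InnerProductSpace.toDual ℝ E).symm (LinearMap.toContinuousLinearMap g), fun i => ?_⟩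
  rw [real_inner_comm, InnerProductSpace.toDual_symm_apply]
  have h1 := LinearMap.congr_fun hg (Module.Basis.span hv i)
  rw [Module.Basis.constr_basis] at h1
  rw [← h1]
  simp [Module.Basis.span_apply]

/-- Vectors without a nonzero relation take arbitrary prescribed inner products. -/
theorem exists_inner_eq_of_relation_eq_zero {S : Finset E}
    (h : ∀ c, IsRelation id S c → ∀ u, c u = 0) (t : E → ℝ) :
    ∃ x : E, ∀ u ∈ S, inner ℝ u x = t u := by
  obtain ⟨x, hx⟩ := (linearIndependent_of_relation_eq_zero h).exists_inner_eq (fun u => t u)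
  exact ⟨x, fun u hu => hx ⟨u, hu⟩⟩

/-- Without one vector `e` of the support, the rest is independent and takes any prescribed
products; the relation then forces the right product at `e`. -/
theorem IsCircuit.exists_inner_eq {c : E → ℝ} (hc : IsCircuit id N c) {t : E → ℝ}
    (ht : ∑ u ∈ N, c u * t u = 0) : ∃ x : E, ∀ u, c u ≠ 0 → inner ℝ u x = t u := by
  classical
  obtain ⟨e, he⟩ := hc.ne_zero
  have heN := hc.mem he
  obtain ⟨x, hx⟩ := exists_inner_eq_of_relation_eq_zero
    (S := (N.filter (fun u => c u ≠ 0)).erase e) (fun d hd => by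
      have hd0 : ∀ u, c u = 0 → d u = 0 := fun u hu => hd.supp u (by simp [hu])
      obtain ⟨s, hs⟩ := hc.eq_smul d
        (hd.mono ((Finset.erase_subset _ _).trans (Finset.filter_subset _ _))) hd0
      have hs0 : s = 0 := by
        have h1 := hs e
        rw [hd.supp e (by simp)] at h1
        exact (mul_eq_zero.1 h1.symm).resolve_right he
      intro u
      rw [hs, hs0, zero_mul]) t
  have hoth : ∀ u, u ≠ e → c u ≠ 0 → inner ℝ u x = t u := fun u hue hu =>
    hx u (by simp [hue, hu, hc.mem hu])
  refine ⟨x, fun u hu => ?_⟩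
  by_cases hue : u = e
  · subst hue
    have h1 := hc.sum_inner x
    rw [← ht, ← Finset.add_sum_erase _ _ heN, ← Finset.add_sum_erase _ _ heN] at h1
    have h2 : ∑ w ∈ N.erase u, c w * inner ℝ w x = ∑ w ∈ N.erase u, c w * t w := by
      refine Finset.sum_congr rfl fun w hw => ?_
      by_cases hw0 : c w = 0
      · simp [hw0]
      · rw [hoth w (Finset.ne_of_mem_erase hw) hw0]
    rw [h2] at h1
    exact mul_left_cancel₀ hu (add_right_cancel h1)
  · exact hoth u hue hu

/-- The sum is the rate at which `∑ c w * h w` grows when a segment in direction `y` is added.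
Choosing `⟨u, y⟩ = 1 / c u`, `⟨v, y⟩ = -1 / c v` and `0` on the rest of the support respects the
relation, and only `u` survives the positive part. -/
theorem IsCircuit.exists_segment_pos {c : E → ℝ} (hc : IsCircuit id N c) {u v : E} (huv : u ≠ v)
    (hu : 0 < c u) (hv : 0 < c v) : ∃ y : E, 0 < ∑ w ∈ N, c w * max (inner ℝ w y) 0 := by
  classical
  set t : E → ℝ := fun w => if w = u then 1 / c u else if w = v then -(1 / c v) else 0 with ht
  have hsum : ∀ f : ℝ → ℝ, f 0 = 0 → ∑ w ∈ N, c w * f (t w)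
      = c u * f (1 / c u) + c v * f (-(1 / c v)) := by
    intro f hf
    rw [← Finset.add_sum_erase _ _ (hc.mem hu.ne'),
      ← Finset.add_sum_erase (a := v) _ _ (by simp [huv.symm, hc.mem hv.ne']),
      Finset.sum_eq_zero, add_zero]
    · simp [ht, huv.symm]
    · intro w hw
      simp only [Finset.mem_erase] at hw
      simp [ht, hw.1, hw.2.1, hf]
  obtain ⟨y, hy⟩ := hc.exists_inner_eq (t := t) (by
    have := hsum id rfl
    simp only [id] at this
    rw [this]
    field_simp
    ring)
  refine ⟨y, ?_⟩
  have h1 : ∑ w ∈ N, c w * max (inner ℝ w y) 0 = ∑ w ∈ N, c w * max (t w) 0 := by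
    refine Finset.sum_congr rfl fun w _ => ?_
    by_cases hw : c w = 0
    · simp [hw]
    · rw [hy w hw]
  rw [h1, hsum (fun s => max s 0) (by simp), max_eq_left (by positivity),
    max_eq_right (neg_nonpos.2 (by positivity))]
  field_simp
  simp

end InnerRelation

/-! ### Faces, facet normals and the facet description of a polytope -/

section Polytope

variable {n : ℕ} {P : Set (EuclideanSpace ℝ (Fin n))}

theorem IsFullPolytope.convex (hP : IsFullPolytope P) : Convex ℝ P := by
  obtain ⟨⟨s, rfl⟩, -⟩ := hP
  exact convex_convexHull ℝ _

theorem IsFullPolytope.isCompact (hP : IsFullPolytope P) : IsCompact P := by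
  obtain ⟨⟨s, rfl⟩, -⟩ := hP
  exact s.finite_toSet.isCompact_convexHull (𝕜 := ℝ)

theorem inner_le_supportFn (hP : IsCompact P) (u : EuclideanSpace ℝ (Fin n))
    {p : EuclideanSpace ℝ (Fin n)} (hp : p ∈ P) : inner ℝ u p ≤ supportFn P u :=
  le_csSup (hP.image (by fun_prop)).bddAbove ⟨p, hp, rfl⟩

theorem supportFn_eq_of_isMax {u x : EuclideanSpace ℝ (Fin n)} (hx : x ∈ P)
    (h : ∀ y ∈ P, inner ℝ u y ≤ inner ℝ u x) : supportFn P u = inner ℝ u x :=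
  IsGreatest.csSup_eq ⟨⟨x, hx, rfl⟩, by rintro _ ⟨y, hy, rfl⟩; exact h y hy⟩

theorem supportFn_eq_of_mem_faceIn {u x : EuclideanSpace ℝ (Fin n)} (hx : x ∈ faceIn P u) :
    supportFn P u = inner ℝ u x :=
  supportFn_eq_of_isMax hx.1 hx.2

theorem inner_lt_of_mem_interior {u p : EuclideanSpace ℝ (Fin n)} (hu : u ≠ 0)
    (hp : p ∈ interior P) {a : ℝ} (h : ∀ y ∈ P, inner ℝ u y ≤ a) : inner ℝ u p < a := by
  have hcont : Filter.Tendsto (fun t : ℝ => p + t • u) (nhdsWithin 0 (Set.Ioi 0)) (nhds p) := by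
    have h1 : Continuous (fun t : ℝ => p + t • u) := by fun_prop
    have h2 := h1.tendsto 0
    simp only [zero_smul, add_zero] at h2
    exact h2.mono_left nhdsWithin_le_nhds
  have hev := (hcont.eventually (isOpen_interior.mem_nhds hp)).and self_mem_nhdsWithin
  obtain ⟨t, ht, ht0⟩ := hev.exists
  have h3 := h _ (interior_subset ht)
  rw [inner_add_right, real_inner_smul_right] at h3
  have h4 : 0 < t * inner ℝ u u := mul_pos ht0 (real_inner_self_pos.2 hu)
  linarith

theorem inner_eq_of_mem_vectorSpan_faceIn {u d : EuclideanSpace ℝ (Fin n)}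
    (hd : d ∈ vectorSpan ℝ (faceIn P u)) : inner ℝ u d = 0 := by
  have hle : vectorSpan ℝ (faceIn P u) ≤ (Submodule.span ℝ {u})ᗮ := by
    refine Submodule.span_le.2 ?_
    rintro _ ⟨x, hx, y, hy, rfl⟩
    change x - y ∈ _
    rw [SetLike.mem_coe, Submodule.mem_orthogonal_singleton_iff_inner_right,
      inner_sub_right, sub_eq_zero]
    exact le_antisymm (hy.2 x hx.1) (hx.2 y hy.1)
  exact Submodule.mem_orthogonal_singleton_iff_inner_right.1 (hle hd)

theorem finrank_orthogonal_singleton {u : EuclideanSpace ℝ (Fin n)} (hu : u ≠ 0) :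
    Module.finrank ℝ (Submodule.span ℝ {u})ᗮ + 1 = n := by
  have := Submodule.finrank_add_finrank_orthogonal (Submodule.span ℝ {u})
  rw [finrank_span_singleton hu, finrank_euclideanSpace_fin] at this
  omega

theorem finrank_vectorSpan_faceIn_le {u : EuclideanSpace ℝ (Fin n)} (hu : u ≠ 0) :
    Module.finrank ℝ (vectorSpan ℝ (faceIn P u)) + 1 ≤ n := by
  have hle : vectorSpan ℝ (faceIn P u) ≤ (Submodule.span ℝ {u})ᗮ := fun d hd =>
    Submodule.mem_orthogonal_singleton_iff_inner_right.2 (inner_eq_of_mem_vectorSpan_faceIn hd)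
  exact (Nat.succ_le_succ (Submodule.finrank_mono hle)).trans_eq (finrank_orthogonal_singleton hu)

/-- A hyperplane has only two unit normal vectors. -/
theorem eq_or_eq_neg_of_orthogonal {A : Submodule ℝ (EuclideanSpace ℝ (Fin n))}
    (hA : Module.finrank ℝ A + 1 = n) {u w : EuclideanSpace ℝ (Fin n)} (hu : ‖u‖ = 1)
    (hw : ‖w‖ = 1) (hAu : ∀ d ∈ A, inner ℝ u d = 0) (hAw : ∀ d ∈ A, inner ℝ w d = 0) :
    w = u ∨ w = -u := by
  have hu0 : u ≠ 0 := by rintro rfl; simp at hu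
  have hle : A ≤ (Submodule.span ℝ {u})ᗮ := fun d hd =>
    Submodule.mem_orthogonal_singleton_iff_inner_right.2 (hAu d hd)
  have heq : A = (Submodule.span ℝ {u})ᗮ := by
    apply Submodule.eq_of_le_of_finrank_eq hle
    have := finrank_orthogonal_singleton hu0
    omega
  have hwmem : w ∈ Submodule.span ℝ {u} := by
    rw [← Submodule.orthogonal_orthogonal (Submodule.span ℝ {u}), ← heq]
    exact (Submodule.mem_orthogonal' A w).2 hAw
  obtain ⟨r, rfl⟩ := Submodule.mem_span_singleton.1 hwmem
  rw [norm_smul, hu, mul_one, Real.norm_eq_abs] at hw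
  rcases (abs_eq zero_le_one).1 hw with h | h <;> simp [h]

theorem ne_zero_of_mem_facetNormals {u : EuclideanSpace ℝ (Fin n)} (hu : u ∈ facetNormals P) :
    u ≠ 0 := by
  rintro rfl
  simpa using hu.1

theorem exists_mem_faceIn_inner_eq {u : EuclideanSpace ℝ (Fin n)} (hu : u ∈ facetNormals P) :
    ∃ x ∈ P, inner ℝ u x = supportFn P u := by
  obtain ⟨x, hx⟩ := hu.2.1
  exact ⟨x, hx.1, (supportFn_eq_of_mem_faceIn hx).symm⟩

theorem inner_lt_supportFn (hP : IsFullPolytope P) {u p : EuclideanSpace ℝ (Fin n)}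
    (hu : u ∈ facetNormals P) (hp : p ∈ interior P) : inner ℝ u p < supportFn P u :=
  inner_lt_of_mem_interior (ne_zero_of_mem_facetNormals hu) hp
    fun _ hy => inner_le_supportFn hP.isCompact u hy

/-- Opposite functionals do not attain their maxima at a common point of a full-dimensional set. -/
theorem ne_neg_of_mem_faceIn (hP : (interior P).Nonempty) {u w x : EuclideanSpace ℝ (Fin n)}
    (hu : u ≠ 0) (hx : x ∈ faceIn P u) (hx' : x ∈ faceIn P w) : w ≠ -u := by
  rintro rfl
  obtain ⟨p, hp⟩ := hP
  have h1 := inner_lt_of_mem_interior hu hp hx.2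
  have h2 := hx'.2 p (interior_subset hp)
  simp only [inner_neg_left] at h2
  linarith

/-- In a convex combination that attains the maximum, every point of nonzero weight attains it too.
-/
theorem faceIn_convexHull_subset (s : Finset (EuclideanSpace ℝ (Fin n)))
    (u : EuclideanSpace ℝ (Fin n)) :
    faceIn (convexHull ℝ (s : Set (EuclideanSpace ℝ (Fin n)))) u ⊆
      convexHull ℝ {y | y ∈ s ∧ y ∈ faceIn (convexHull ℝ (s : Set (EuclideanSpace ℝ (Fin n)))) u} := by
  classical
  intro x hx
  obtain ⟨w, hw0, hw1, hwx⟩ := Finset.mem_convexHull'.1 hx.1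
  have hle : ∀ y ∈ s, inner ℝ u y ≤ inner ℝ u x := fun y hy => hx.2 y (subset_convexHull ℝ _ hy)
  have hsum : ∑ y ∈ s, w y * (inner ℝ u x - inner ℝ u y) = 0 := by
    simp only [mul_sub, Finset.sum_sub_distrib, ← Finset.sum_mul, hw1, one_mul]
    conv_lhs => rw [← hwx]
    simp [inner_sum, real_inner_smul_right]
  have hz := (Finset.sum_eq_zero_iff_of_nonneg (fun y hy =>
    mul_nonneg (hw0 y hy) (sub_nonneg.2 (hle y hy)))).1 hsum
  have hmem : ∀ y ∈ s, w y ≠ 0 →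
      y ∈ faceIn (convexHull ℝ (s : Set (EuclideanSpace ℝ (Fin n)))) u := by
    intro y hy hwy
    have h1 : inner ℝ u x = inner ℝ u y :=
      sub_eq_zero.1 ((mul_eq_zero.1 (hz y hy)).resolve_left hwy)
    exact ⟨subset_convexHull ℝ _ hy, fun z hz => h1 ▸ hx.2 z hz⟩
  rw [← Finset.sum_filter_ne_zero] at hw1
  rw [← Finset.sum_filter_of_ne (p := fun y => w y ≠ 0)
    (fun y _ h h0 => h (by rw [h0, zero_smul]))] at hwx
  rw [← hwx]
  refine (convex_convexHull ℝ _).sum_mem (fun y hy => hw0 y (Finset.mem_filter.1 hy).1) hw1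
    fun y hy => subset_convexHull ℝ _ ?_
  obtain ⟨h1, h2⟩ := Finset.mem_filter.1 hy
  exact ⟨h1, hmem y h1 h2⟩

theorem vectorSpan_convexHull (s : Set (EuclideanSpace ℝ (Fin n))) :
    vectorSpan ℝ (convexHull ℝ s) = vectorSpan ℝ s := by
  rw [← direction_affineSpan, affineSpan_convexHull, direction_affineSpan]

theorem vectorSpan_faceIn_convexHull (s : Finset (EuclideanSpace ℝ (Fin n)))
    (u : EuclideanSpace ℝ (Fin n)) :
    vectorSpan ℝ (faceIn (convexHull ℝ (s : Set (EuclideanSpace ℝ (Fin n)))) u) =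
      vectorSpan ℝ {y | y ∈ s ∧ y ∈ faceIn (convexHull ℝ (s : Set (EuclideanSpace ℝ (Fin n)))) u} := by
  refine le_antisymm ?_ (vectorSpan_mono ℝ fun y hy => hy.2)
  rw [← vectorSpan_convexHull {y | y ∈ s ∧ _}]
  exact vectorSpan_mono ℝ (faceIn_convexHull_subset s u)

/-- A facet normal is determined by the points of `s` on its facet: these span the facet's
direction, which leaves two opposite unit normals, and opposite normals cannot share a face point.
-/
theorem finite_facetNormals (hP : IsFullPolytope P) : (facetNormals P).Finite := by
  classical
  obtain ⟨⟨s, rfl⟩, hint⟩ := hP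
  set P := convexHull ℝ (s : Set (EuclideanSpace ℝ (Fin n)))
  refine Set.Finite.of_injOn (f := fun u => s.filter (fun y => y ∈ faceIn P u))
    (t := (s.powerset : Set (Finset _))) (fun u _ => Finset.mem_coe.2 (Finset.mem_powerset.2 (Finset.filter_subset _ _))) ?_ (Finset.finite_toSet _)
  intro u hu w hw huw
  have hset : {y | y ∈ s ∧ y ∈ faceIn P u} = {y | y ∈ s ∧ y ∈ faceIn P w} := by
    ext y
    have := Finset.ext_iff.1 huw y
    simpa using this
  have hspan : vectorSpan ℝ (faceIn P u) = vectorSpan ℝ (faceIn P w) := by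
    rw [vectorSpan_faceIn_convexHull, vectorSpan_faceIn_convexHull, hset]
  obtain ⟨x, hx⟩ := convexHull_nonempty_iff.1 (hu.2.1.mono (faceIn_convexHull_subset s u))
  have hx' : x ∈ s ∧ x ∈ faceIn P w := by
    have : x ∈ {y | y ∈ s ∧ y ∈ faceIn P u} := hx
    rwa [hset] at this
  rcases eq_or_eq_neg_of_orthogonal hu.2.2 hu.1 hw.1
    (fun d hd => inner_eq_of_mem_vectorSpan_faceIn hd)
    (fun d hd => inner_eq_of_mem_vectorSpan_faceIn (hspan ▸ hd)) with h | h
  · exact h.symm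
  · exact absurd h (ne_neg_of_mem_faceIn hint (ne_zero_of_mem_facetNormals hu) hx.2 hx'.2)

/-- A full-dimensional polytope is the intersection of its facet half-spaces. -/
theorem mem_of_forall_facetNormals (hP : IsFullPolytope P) {y : EuclideanSpace ℝ (Fin n)}
    (hy : ∀ u ∈ facetNormals P, inner ℝ u y ≤ supportFn P u) : y ∈ P := by
  classical
  by_contra hyP
  have hPconv := hP.convex
  have hPcl := hP.isCompact.isClosed
  obtain ⟨⟨s, hs⟩, hint⟩ := hP
  -- Faces of dimension at most `n - 2` are hulls of such subsets. Together with `y` each spans a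
  -- proper flat, which is null, so an interior point `p` can avoid them all.
  set 𝒯 := s.powerset.filter
    (fun t : Finset _ => Module.finrank ℝ (vectorSpan ℝ (t : Set (EuclideanSpace ℝ (Fin n)))) + 2 ≤ n)
  have hnull : MeasureTheory.volume (⋃ t ∈ 𝒯,
      (affineSpan ℝ (insert y (t : Set (EuclideanSpace ℝ (Fin n)))) :
        Set (EuclideanSpace ℝ (Fin n)))) = 0 := by
    refine (MeasureTheory.measure_biUnion_null_iff (Finset.countable_toSet 𝒯)).2 fun t ht => ?_
    refine MeasureTheory.Measure.addHaar_affineSubspace _ _ fun htop => ?_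
    have h1 : Module.finrank ℝ
        (vectorSpan ℝ (insert y (t : Set (EuclideanSpace ℝ (Fin n))))) = n := by
      rw [← direction_affineSpan, htop, AffineSubspace.direction_top, finrank_top,
        finrank_euclideanSpace_fin]
    have h2 := finrank_vectorSpan_insert_le_set ℝ (t : Set (EuclideanSpace ℝ (Fin n))) y
    have h3 := (Finset.mem_filter.1 ht).2
    omega
  obtain ⟨p, hp, hpnot⟩ : ∃ p ∈ interior P, p ∉ ⋃ t ∈ 𝒯,
      (affineSpan ℝ (insert y (t : Set (EuclideanSpace ℝ (Fin n)))) :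
        Set (EuclideanSpace ℝ (Fin n))) := by
    by_contra! hcon
    have hpos := isOpen_interior.measure_pos MeasureTheory.volume hint
    exact hpos.ne' (MeasureTheory.measure_mono_null hcon hnull)
  obtain ⟨z, hzseg, hzfr⟩ : ∃ z ∈ segment ℝ p y, z ∈ frontier P := by
    have hpre : IsPreconnected (segment ℝ p y) := (convex_segment p y).isPreconnected
    by_contra! hcon
    have h1 : segment ℝ p y ⊆ interior P ∪ Pᶜ := by
      intro z hz
      have := hcon z hz
      rw [hPcl.frontier_eq] at this
      by_cases hzP : z ∈ P
      · exact Or.inl (by_contra fun h => this ⟨hzP, h⟩)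
      · exact Or.inr hzP
    obtain ⟨z, -, hz1, hz2⟩ := hpre _ _ isOpen_interior hPcl.isOpen_compl h1
      ⟨p, left_mem_segment ℝ p y, hp⟩ ⟨y, right_mem_segment ℝ p y, hyP⟩
    exact hz2 (interior_subset hz1)
  have hzP : z ∈ P := hPcl.frontier_subset hzfr
  have hzint : z ∉ interior P := by
    rw [hPcl.frontier_eq] at hzfr
    exact hzfr.2
  obtain ⟨f, hf⟩ := geometric_hahn_banach_open_point hPconv.interior isOpen_interior hzint
  set w := (InnerProductSpace.toDual ℝ (EuclideanSpace ℝ (Fin n))).symm f with hw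
  have hfw : ∀ x, f x = inner ℝ w x := fun x => by
    rw [hw, InnerProductSpace.toDual_symm_apply]
  have hw0 : w ≠ 0 := by
    intro h0
    have := hf p hp
    rw [hfw, hfw, h0] at this
    simp at this
  have hmax : ∀ x ∈ P, inner ℝ w x ≤ inner ℝ w z := by
    intro x hx
    have hx' : x ∈ closure (interior P) := by
      rw [hPconv.closure_interior_eq_closure_of_nonempty_interior hint]
      exact subset_closure hx
    have hcl : IsClosed {x | inner ℝ w x ≤ inner ℝ w z} :=
      isClosed_le (by fun_prop) continuous_const
    exact closure_minimal (fun a ha => by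
      have := hf a ha
      rw [hfw, hfw] at this
      exact this.le) hcl hx'
  set u := ‖w‖⁻¹ • w with hu
  have hw1 : 0 < ‖w‖ := norm_pos_iff.2 hw0
  have hu1 : ‖u‖ = 1 := by
    rw [hu, norm_smul, norm_inv, norm_norm, inv_mul_cancel₀ hw1.ne']
  have hu0 : u ≠ 0 := by intro h; simp [h] at hu1
  have hzface : z ∈ faceIn P u := by
    refine ⟨hzP, fun x hx => ?_⟩
    rw [hu, real_inner_smul_left, real_inner_smul_left]
    exact mul_le_mul_of_nonneg_left (hmax x hx) (inv_nonneg.2 hw1.le)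
  have hzy : z ≠ y := fun h => hyP (h ▸ hzP)
  obtain ⟨a, b, ha, hb, hab, hz⟩ := hzseg
  have ha0 : a ≠ 0 := by
    rintro rfl
    apply hzy
    rw [← hz, zero_smul, zero_add, show b = 1 by linarith, one_smul]
  have hfacet : u ∈ facetNormals P := by
    refine ⟨hu1, ⟨z, hzface⟩, ?_⟩
    have hle := finrank_vectorSpan_faceIn_le (P := P) hu0
    by_contra hne
    -- If the face through `z` were smaller than a facet, the line through `y` and `z`, which
    -- contains `p`, would lie in one of the avoided flats.
    set t := s.filter (fun x => x ∈ faceIn P u) with ht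
    have htset : (t : Set (EuclideanSpace ℝ (Fin n))) = {x | x ∈ s ∧ x ∈ faceIn P u} := by
      ext x; simp [ht]
    have hspan : vectorSpan ℝ (faceIn P u) = vectorSpan ℝ (t : Set (EuclideanSpace ℝ (Fin n))) := by
      rw [htset]
      subst hs
      exact vectorSpan_faceIn_convexHull s u
    have htT : t ∈ 𝒯 := by
      refine Finset.mem_filter.2 ⟨by simp [ht], ?_⟩
      rw [← hspan]
      omega
    apply hpnot
    refine Set.mem_biUnion htT ?_
    have hzt : z ∈ affineSpan ℝ (insert y (t : Set (EuclideanSpace ℝ (Fin n)))) := by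
      have h1 : z ∈ convexHull ℝ (t : Set (EuclideanSpace ℝ (Fin n))) := by
        rw [htset]
        subst hs
        exact faceIn_convexHull_subset s u hzface
      exact affineSpan_mono ℝ (Set.subset_insert _ _) (convexHull_subset_affineSpan _ h1)
    have hyt : y ∈ affineSpan ℝ (insert y (t : Set (EuclideanSpace ℝ (Fin n)))) :=
      mem_affineSpan ℝ (Set.mem_insert _ _)
    have hpl : p = AffineMap.lineMap y z (1 / a) := by
      rw [AffineMap.lineMap_apply, vsub_eq_sub, vadd_eq_add, ← hz, show b = 1 - a by linarith]
      rw [show a • p + (1 - a) • y - y = a • (p - y) by module, smul_smul, one_div,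
        inv_mul_cancel₀ ha0, one_smul, sub_add_cancel]
    rw [hpl]
    exact AffineMap.lineMap_mem _ hyt hzt
  have h1 := hy u hfacet
  rw [supportFn_eq_of_mem_faceIn hzface] at h1
  have h2 := inner_lt_of_mem_interior hu0 hp hzface.2
  rw [← hz] at h1 h2
  simp only [inner_add_right, real_inner_smul_right] at h1 h2
  have ha' : 0 < a := lt_of_le_of_ne ha (Ne.symm ha0)
  obtain rfl : b = 1 - a := by linarith
  by_cases ha1 : a = 1
  · subst ha1
    linarith
  · have hb' : 0 < 1 - a := lt_of_le_of_ne hb (fun h => ha1 (by linarith))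
    nlinarith

end Polytope

/-! ### Intersections of half-spaces and the addition of a segment -/

section HalfSpaces

variable {n : ℕ} {P : Set (EuclideanSpace ℝ (Fin n))}

theorem isOpen_setOf_forall_inner_lt {N : Set (EuclideanSpace ℝ (Fin n))} (hN : N.Finite)
    (h : EuclideanSpace ℝ (Fin n) → ℝ) :
    IsOpen {x : EuclideanSpace ℝ (Fin n) | ∀ u ∈ N, inner ℝ u x < h u} := by
  simp only [Set.ofPred_forall]
  exact hN.isOpen_biInter fun u _ => isOpen_lt (by fun_prop) continuous_const

theorem mem_interior_iff_forall_facetNormals (hP : IsFullPolytope P)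
    {y : EuclideanSpace ℝ (Fin n)} :
    y ∈ interior P ↔ ∀ u ∈ facetNormals P, inner ℝ u y < supportFn P u := by
  refine ⟨fun hy u hu => inner_lt_supportFn hP hu hy, fun hy => ?_⟩
  refine mem_interior.2 ⟨_, fun x hx => ?_,
    isOpen_setOf_forall_inner_lt (finite_facetNormals hP) (supportFn P), hy⟩
  exact mem_of_forall_facetNormals hP fun u hu => (hx u hu).le

/-- Otherwise `P` would contain a ray in direction `d`, against boundedness. Thus `N(P)` positively
spans the space. -/
theorem eq_zero_of_forall_inner_nonpos (hP : IsFullPolytope P) {d : EuclideanSpace ℝ (Fin n)}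
    (hd : ∀ u ∈ facetNormals P, inner ℝ u d ≤ 0) : d = 0 := by
  obtain ⟨p, hp⟩ := hP.2.mono interior_subset
  obtain ⟨R, hR⟩ := hP.isCompact.isBounded.exists_norm_le
  by_contra hd0
  have hmem : ∀ t : ℝ, 0 ≤ t → p + t • d ∈ P := fun t ht =>
    mem_of_forall_facetNormals hP fun u hu => by
      rw [inner_add_right, real_inner_smul_right]
      have h1 := inner_le_supportFn hP.isCompact u hp
      have h2 := mul_nonneg ht (neg_nonneg.2 (hd u hu))
      linarith
  have hd' : 0 < ‖d‖ := norm_pos_iff.2 hd0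
  have hR0 : 0 ≤ R := (norm_nonneg _).trans (hR p hp)
  set t := (2 * R + 1) / ‖d‖ with ht
  have ht0 : 0 ≤ t := by positivity
  have h1 := hR _ (hmem t ht0)
  have h2 : ‖t • d‖ = 2 * R + 1 := by
    rw [norm_smul, Real.norm_of_nonneg ht0, ht, div_mul_cancel₀ _ hd'.ne']
  have h3 : ‖t • d‖ ≤ ‖p + t • d‖ + ‖p‖ := by
    simpa using norm_sub_le (p + t • d) p
  linarith [hR p hp]

theorem convex_faceIn (hP : Convex ℝ P) (u : EuclideanSpace ℝ (Fin n)) :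
    Convex ℝ (faceIn P u) := by
  intro x hx y hy a b ha hb hab
  refine ⟨hP hx.1 hy.1 ha hb hab, fun z hz => ?_⟩
  rw [inner_add_right, real_inner_smul_right, real_inner_smul_right]
  have h1 := mul_le_mul_of_nonneg_left (hx.2 z hz) ha
  have h2 := mul_le_mul_of_nonneg_left (hy.2 z hz) hb
  have h3 : inner ℝ u z = a * inner ℝ u z + b * inner ℝ u z := by rw [← add_mul, hab, one_mul]
  linarith

/-- Finitely many linear inequalities on a convex set, each of which is strict somewhere, are
simultaneously strict somewhere. -/
theorem exists_forall_inner_lt {F : Set (EuclideanSpace ℝ (Fin n))} (hF : Convex ℝ F)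
    (hne : F.Nonempty) {N : Set (EuclideanSpace ℝ (Fin n))} (hN : N.Finite)
    {h : EuclideanSpace ℝ (Fin n) → ℝ} (hle : ∀ u ∈ N, ∀ x ∈ F, inner ℝ u x ≤ h u)
    (hlt : ∀ u ∈ N, ∃ x ∈ F, inner ℝ u x < h u) : ∃ x ∈ F, ∀ u ∈ N, inner ℝ u x < h u := by
  induction N, hN using Set.Finite.induction_on with
  | empty => exact ⟨hne.some, hne.some_mem, by simp⟩
  | @insert v S _ _ ih =>
    obtain ⟨x, hx, hxS⟩ := ih (fun u hu => hle u (Set.mem_insert_of_mem _ hu))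
      (fun u hu => hlt u (Set.mem_insert_of_mem _ hu))
    obtain ⟨y, hy, hyv⟩ := hlt v (Set.mem_insert _ _)
    refine ⟨(1 / 2 : ℝ) • x + (1 / 2 : ℝ) • y,
      hF hx hy (by norm_num) (by norm_num) (by norm_num), fun u hu => ?_⟩
    rw [inner_add_right, real_inner_smul_right, real_inner_smul_right]
    rcases hu with rfl | hu
    · linarith [hle u (Set.mem_insert _ _) x hx]
    · linarith [hle u (Set.mem_insert_of_mem _ hu) y hy, hxS u hu]

theorem convex_halfSpaces (N : Set (EuclideanSpace ℝ (Fin n)))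
    (h : EuclideanSpace ℝ (Fin n) → ℝ) :
    Convex ℝ {x : EuclideanSpace ℝ (Fin n) | ∀ u ∈ N, inner ℝ u x ≤ h u} := by
  intro x hx y hy a b ha hb hab u hu
  rw [inner_add_right, real_inner_smul_right, real_inner_smul_right]
  have h1 := mul_le_mul_of_nonneg_left (hx u hu) ha
  have h2 := mul_le_mul_of_nonneg_left (hy u hu) hb
  have h3 : h u = a * h u + b * h u := by rw [← add_mul, hab, one_mul]
  linarith

theorem eventually_add_smul_mem_halfSpaces {N : Set (EuclideanSpace ℝ (Fin n))} (hN : N.Finite)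
    {h : EuclideanSpace ℝ (Fin n) → ℝ} {x d : EuclideanSpace ℝ (Fin n)}
    (hx : ∀ u ∈ N, inner ℝ u x ≤ h u) (hd : ∀ u ∈ N, inner ℝ u x = h u → inner ℝ u d = 0) :
    ∀ᶠ t : ℝ in nhds 0, ∀ u ∈ N, inner ℝ u (x + t • d) ≤ h u := by
  refine (Filter.eventually_all_finite hN).2 fun u hu => ?_
  by_cases hux : inner ℝ u x = h u
  · filter_upwards with t
    rw [inner_add_right, real_inner_smul_right, hd u hu hux, mul_zero, add_zero]
    exact hx u hu
  · have hlt : inner ℝ u x < h u := lt_of_le_of_ne (hx u hu) hux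
    have hcont : Continuous (fun t : ℝ => inner ℝ u (x + t • d)) := by fun_prop
    have := hcont.tendsto 0
    simp only [zero_smul, add_zero] at this
    filter_upwards [this.eventually (gt_mem_nhds hlt)] with t ht using ht.le

/-- An extreme point is determined by its active constraints: if `x` and `y` had the same ones, `x`
could be moved a little both ways along `y - x`. -/
theorem finite_extremePoints_halfSpaces {N : Set (EuclideanSpace ℝ (Fin n))} (hN : N.Finite)
    (h : EuclideanSpace ℝ (Fin n) → ℝ) :
    ({x : EuclideanSpace ℝ (Fin n) | ∀ u ∈ N, inner ℝ u x ≤ h u}.extremePoints ℝ).Finite := by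
  refine Set.Finite.of_injOn (f := fun x => {u | u ∈ N ∧ inner ℝ u x = h u}) (t := N.powerset)
    (fun x _ u hu => hu.1) ?_ hN.finite_subsets
  intro x hx y hy hxy
  by_contra hne
  have hact : ∀ u ∈ N, inner ℝ u x = h u → inner ℝ u (y - x) = 0 := by
    intro u hu hux
    have : u ∈ {u | u ∈ N ∧ inner ℝ u y = h u} := by
      have hmem : u ∈ {u | u ∈ N ∧ inner ℝ u x = h u} := ⟨hu, hux⟩
      exact (Set.ext_iff.1 hxy u).1 hmem
    rw [inner_sub_right, hux, this.2, sub_self]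
  have hev := eventually_add_smul_mem_halfSpaces hN hx.1 hact
  have hneg : Filter.Tendsto (fun t : ℝ => -t) (nhds 0) (nhds 0) := by
    simpa using (continuous_neg (G := ℝ)).tendsto 0
  have hboth := ((hev.and (hneg.eventually hev)).filter_mono
    (nhdsWithin_le_nhds (s := Set.Ioi (0 : ℝ)))).and self_mem_nhdsWithin
  obtain ⟨t, ⟨h1, h2⟩, ht⟩ := hboth.exists
  have hseg : x ∈ openSegment ℝ (x + t • (y - x)) (x + (-t) • (y - x)) :=
    ⟨1 / 2, 1 / 2, by norm_num, by norm_num, by norm_num, by module⟩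
  have h3 := (mem_extremePoints.1 hx).2 _ h1 _ h2 hseg
  have h4 : t • (y - x) = 0 := by simpa using h3.1
  exact hne (sub_eq_zero.1 ((smul_eq_zero.1 h4).resolve_left (ne_of_gt ht))).symm

/-- A bounded intersection of finitely many half-spaces, each of which contributes a facet, is a
full-dimensional polytope with the expected normals and support numbers. -/
theorem isFullPolytope_halfSpaces {N : Set (EuclideanSpace ℝ (Fin n))} (hN : N.Finite)
    (hN1 : ∀ u ∈ N, ‖u‖ = 1) {h : EuclideanSpace ℝ (Fin n) → ℝ}
    {Q : Set (EuclideanSpace ℝ (Fin n))} (hQ : Q = {x | ∀ u ∈ N, inner ℝ u x ≤ h u})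
    (hb : Bornology.IsBounded Q) {p : EuclideanSpace ℝ (Fin n)}
    (hp : ∀ u ∈ N, inner ℝ u p < h u)
    (hfacet : ∀ u ∈ N, ∃ F ⊆ Q, F.Nonempty ∧ (∀ x ∈ F, inner ℝ u x = h u) ∧
      n ≤ Module.finrank ℝ (vectorSpan ℝ F) + 1) :
    IsFullPolytope Q ∧ facetNormals Q = N ∧ ∀ u ∈ N, supportFn Q u = h u := by
  have hconv : Convex ℝ Q := hQ ▸ convex_halfSpaces N h
  have hclosed : IsClosed Q := by
    rw [hQ]
    simp only [Set.ofPred_forall]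
    exact isClosed_biInter fun u _ => isClosed_le (by fun_prop) continuous_const
  have hcpt : IsCompact Q := Metric.isCompact_of_isClosed_isBounded hclosed hb
  have hstrict : ∀ x, (∀ u ∈ N, inner ℝ u x < h u) → x ∈ interior Q := fun x hx =>
    mem_interior.2 ⟨_, fun y hy => by
      rw [hQ]; exact fun u hu => (hy u hu).le, isOpen_setOf_forall_inner_lt hN h, hx⟩
  have hint : (interior Q).Nonempty := ⟨p, hstrict p hp⟩
  have hle : ∀ u ∈ N, ∀ x ∈ Q, inner ℝ u x ≤ h u := fun u hu x hx => by
    rw [hQ] at hx; exact hx u hu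
  have hne0 : ∀ u ∈ N, u ≠ 0 := by
    rintro u hu rfl
    simpa using hN1 _ hu
  have hface : ∀ u ∈ N, ∀ x ∈ Q, inner ℝ u x = h u → x ∈ faceIn Q u := fun u hu x hx hux =>
    ⟨hx, fun y hy => hux ▸ hle u hu y hy⟩
  have hfull : IsFullPolytope Q := by
    refine ⟨?_, hint⟩
    have hfin : (Q.extremePoints ℝ).Finite := hQ ▸ finite_extremePoints_halfSpaces hN h
    refine ⟨hfin.toFinset, ?_⟩
    rw [hfin.coe_toFinset, ← (hfin.isCompact_convexHull (𝕜 := ℝ)).isClosed.closure_eq,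
      closure_convexHull_extremePoints hcpt hconv]
  refine ⟨hfull, Set.Subset.antisymm ?_ ?_, ?_⟩
  · intro w hw
    have hw0 := ne_zero_of_mem_facetNormals hw
    -- A face contained in none of the bounding hyperplanes would have a point strictly inside all
    -- of them, that is, an interior point of `Q`.
    obtain ⟨u, hu, hua⟩ : ∃ u ∈ N, ∀ x ∈ faceIn Q w, inner ℝ u x = h u := by
      by_contra! hcon
      obtain ⟨x, hx, hxN⟩ := exists_forall_inner_lt (convex_faceIn hconv w) hw.2.1 hN
        (fun u hu x hx => hle u hu x hx.1) (fun u hu => by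
          obtain ⟨x, hx, hne⟩ := hcon u hu
          exact ⟨x, hx, lt_of_le_of_ne (hle u hu x hx.1) hne⟩)
      exact lt_irrefl _ (inner_lt_of_mem_interior hw0 (hstrict x hxN) hx.2)
    have hsub : faceIn Q w ⊆ faceIn Q u := fun x hx => hface u hu x hx.1 (hua x hx)
    rcases eq_or_eq_neg_of_orthogonal hw.2.2 (hN1 u hu) hw.1
      (fun d hd => inner_eq_of_mem_vectorSpan_faceIn (vectorSpan_mono ℝ hsub hd))
      (fun d hd => inner_eq_of_mem_vectorSpan_faceIn hd) with heq | heq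
    · exact heq ▸ hu
    · obtain ⟨x, hx⟩ := hw.2.1
      exact absurd heq (ne_neg_of_mem_faceIn hint (hne0 u hu) (hsub hx) hx)
  · intro u hu
    obtain ⟨F, hFQ, hFne, hFu, hFdim⟩ := hfacet u hu
    have hsub : F ⊆ faceIn Q u := fun x hx => hface u hu x (hFQ hx) (hFu x hx)
    refine ⟨hN1 u hu, hFne.mono hsub, le_antisymm (finrank_vectorSpan_faceIn_le (hne0 u hu)) ?_⟩
    exact hFdim.trans (Nat.succ_le_succ (Submodule.finrank_mono (vectorSpan_mono ℝ hsub)))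
  · intro u hu
    obtain ⟨F, hFQ, ⟨x, hx⟩, hFu, -⟩ := hfacet u hu
    rw [supportFn_eq_of_mem_faceIn (hface u hu x (hFQ hx) (hFu x hx)), hFu x hx]

/-- Adding the segment from `0` to `y` to a full-dimensional polytope `P`, and then discarding all
facets with normals not in `N(P)`, gives a polytope with the normals of `P`. -/
theorem exists_polytope_add_segment (hP : IsFullPolytope P) (y : EuclideanSpace ℝ (Fin n)) :
    ∃ Q : Set (EuclideanSpace ℝ (Fin n)), IsFullPolytope Q ∧ facetNormals Q = facetNormals P ∧
      ∀ u ∈ facetNormals P, supportFn Q u = supportFn P u + max (inner ℝ u y) 0 := by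
  obtain ⟨p, hp⟩ := hP.2
  have hNfin := finite_facetNormals hP
  have hlt : ∀ u ∈ facetNormals P, inner ℝ u p < supportFn P u :=
    (mem_interior_iff_forall_facetNormals hP).1 hp
  refine ⟨_, isFullPolytope_halfSpaces hNfin (fun u hu => hu.1) rfl ?_ (p := p) ?_ ?_⟩
  · obtain ⟨R, hR⟩ := (hNfin.image (fun u =>
      max (inner ℝ u y) 0 / (supportFn P u - inner ℝ u p))).bddAbove
    obtain ⟨B, hB⟩ := hP.isCompact.isBounded.exists_norm_le
    -- With this factor, every new slack at `p` is at most `r` times the old one, so the new set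
    -- lies in the dilate of `P` about `p` by `r`.
    set r := max R 0 + 1 with hr
    have hr1 : 1 ≤ r := by simp [hr]
    have hr0 : 0 < r := by linarith
    refine isBounded_iff_forall_norm_le.2 ⟨‖p‖ + r * (B + ‖p‖), fun x hx => ?_⟩
    have hmem : p + r⁻¹ • (x - p) ∈ P := mem_of_forall_facetNormals hP fun u hu => by
      have h1 := hx u hu
      have h2 := sub_pos.2 (hlt u hu)
      have h3 : max (inner ℝ u y) 0 ≤ (r - 1) * (supportFn P u - inner ℝ u p) := by
        have h4 := hR ⟨u, hu, rfl⟩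
        simp only at h4
        rw [div_le_iff₀ h2] at h4
        refine h4.trans (mul_le_mul_of_nonneg_right ?_ h2.le)
        simp [hr]
      have h5 : inner ℝ u (x - p) ≤ r * (supportFn P u - inner ℝ u p) := by
        rw [inner_sub_right]; linarith
      rw [inner_add_right, real_inner_smul_right]
      have h6 := (inv_mul_le_iff₀ hr0).2 h5
      linarith
    have h1 := hB _ hmem
    have h2 : x = p + r • (p + r⁻¹ • (x - p) - p) := by
      rw [add_sub_cancel_left, smul_smul, mul_inv_cancel₀ hr0.ne', one_smul, add_sub_cancel]
    rw [h2]
    refine (norm_add_le _ _).trans ?_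
    gcongr
    rw [norm_smul, Real.norm_of_nonneg hr0.le]
    gcongr
    exact (norm_sub_le _ _).trans (by gcongr)
  · intro u hu
    have := le_max_right (inner ℝ u y) 0
    linarith [hlt u hu]
  · intro u hu
    -- A translate of the old facet serves as part of the new one: by `y` if `0 ≤ ⟨u, y⟩`, and by
    -- `0` otherwise.
    have hshift : ∀ z : EuclideanSpace ℝ (Fin n),
        (∀ w ∈ facetNormals P, inner ℝ w z ≤ max (inner ℝ w y) 0) →
        inner ℝ u z = max (inner ℝ u y) 0 →
        ∃ F ⊆ {x | ∀ w ∈ facetNormals P, inner ℝ w x ≤ supportFn P w + max (inner ℝ w y) 0},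
          F.Nonempty ∧ (∀ x ∈ F, inner ℝ u x = supportFn P u + max (inner ℝ u y) 0) ∧
          n ≤ Module.finrank ℝ (vectorSpan ℝ F) + 1 := by
      intro z hz hzu
      refine ⟨(fun x => z +ᵥ x) '' faceIn P u, ?_, hu.2.1.image _, ?_, ?_⟩
      · rintro _ ⟨x, hx, rfl⟩ w hw
        simp only [vadd_eq_add, inner_add_right]
        linarith [hz w hw, inner_le_supportFn hP.isCompact w hx.1]
      · rintro _ ⟨x, hx, rfl⟩
        simp only [vadd_eq_add, inner_add_right]
        rw [hzu, supportFn_eq_of_mem_faceIn hx, add_comm]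
      · have : vectorSpan ℝ ((fun x => z +ᵥ x) '' faceIn P u) = vectorSpan ℝ (faceIn P u) :=
          vectorSpan_vadd (k := ℝ) (faceIn P u) z
        rw [this, hu.2.2]
    by_cases hy : 0 ≤ inner ℝ u y
    · exact hshift y (fun w _ => le_max_left _ _) (max_eq_left hy).symm
    · exact hshift 0 (fun w _ => by simp) (by rw [inner_zero_right, max_eq_right (not_le.1 hy).le])

end HalfSpaces

/-! ### Chambers of the facet arrangement -/

section Chambers

variable {n : ℕ} {P Q : Set (EuclideanSpace ℝ (Fin n))}

/-- The sign vectors without zeros realized by the hyperplanes `⟨u, x⟩ = h u`, `u ∈ N`. -/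
def chamberSet (N : Set (EuclideanSpace ℝ (Fin n))) (h : EuclideanSpace ℝ (Fin n) → ℝ) :
    Set (N → SignType) :=
  {σ | ∃ x, ∀ u : N, σ u = SignType.sign (inner ℝ (u : EuclideanSpace ℝ (Fin n)) x - h u) ∧
    σ u ≠ 0}

/-- Every point can be moved off finitely many hyperplanes without crossing the hyperplanes that
do not contain it. -/
theorem exists_sign_ne_zero {N : Set (EuclideanSpace ℝ (Fin n))} (hN : N.Finite)
    (hN0 : ∀ u ∈ N, u ≠ 0) (h : EuclideanSpace ℝ (Fin n) → ℝ) (x : EuclideanSpace ℝ (Fin n)) :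
    ∃ x', ∀ u ∈ N, inner ℝ u x' - h u ≠ 0 ∧ (inner ℝ u x - h u ≠ 0 →
      SignType.sign (inner ℝ u x' - h u) = SignType.sign (inner ℝ u x - h u)) := by
  set S := {z : EuclideanSpace ℝ (Fin n) | ∀ u ∈ N, 0 < inner ℝ u x - h u → 0 < inner ℝ u z - h u} ∩
    {z | ∀ u ∈ N, inner ℝ u x - h u < 0 → inner ℝ u z - h u < 0} with hS
  have hSopen : IsOpen S := by
    simp only [hS, Set.ofPred_forall]
    refine IsOpen.inter (hN.isOpen_biInter fun u _ => isOpen_iInter_of_finite fun _ => ?_)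
      (hN.isOpen_biInter fun u _ => isOpen_iInter_of_finite fun _ => ?_)
    · exact isOpen_lt continuous_const (by fun_prop)
    · exact isOpen_lt (by fun_prop) continuous_const
  have hSne : S.Nonempty := ⟨x, fun _ _ h => h, fun _ _ h => h⟩
  have hnull : MeasureTheory.volume
      (⋃ u ∈ N, {z : EuclideanSpace ℝ (Fin n) | inner ℝ u z = h u}) = 0 := by
    refine (MeasureTheory.measure_biUnion_null_iff hN.countable).2 fun u hu => ?_
    by_cases hemp : ∃ z₀ : EuclideanSpace ℝ (Fin n), inner ℝ u z₀ = h u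
    · obtain ⟨z₀, hz₀⟩ := hemp
      refine MeasureTheory.measure_mono_null (t := (AffineSubspace.mk' z₀
        (Submodule.span ℝ {u})ᗮ : Set (EuclideanSpace ℝ (Fin n)))) (fun z hz => ?_)
        (MeasureTheory.Measure.addHaar_affineSubspace _ _ fun htop => ?_)
      · rw [SetLike.mem_coe, AffineSubspace.mem_mk', vsub_eq_sub,
          Submodule.mem_orthogonal_singleton_iff_inner_right, inner_sub_right, hz₀, sub_eq_zero]
        exact hz
      · have hmem : z₀ + u ∈ AffineSubspace.mk' z₀ (Submodule.span ℝ {u})ᗮ :=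
          htop ▸ AffineSubspace.mem_top ℝ _ _
        rw [AffineSubspace.mem_mk', vsub_eq_sub, add_sub_cancel_left,
          Submodule.mem_orthogonal_singleton_iff_inner_right] at hmem
        exact hN0 u hu (inner_self_eq_zero.1 hmem)
    · push Not at hemp
      rw [show {z : EuclideanSpace ℝ (Fin n) | inner ℝ u z = h u} = ∅ from
        Set.eq_empty_of_forall_notMem hemp, MeasureTheory.measure_empty]
  obtain ⟨x', hx', hnot⟩ : ∃ x' ∈ S,
      x' ∉ ⋃ u ∈ N, {z : EuclideanSpace ℝ (Fin n) | inner ℝ u z = h u} := by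
    by_contra! hcon
    exact (hSopen.measure_pos MeasureTheory.volume hSne).ne'
      (MeasureTheory.measure_mono_null hcon hnull)
  refine ⟨x', fun u hu => ⟨fun h0 => hnot (Set.mem_biUnion hu (sub_eq_zero.1 h0)), fun hne => ?_⟩⟩
  rcases lt_or_gt_of_ne hne with hlt | hgt
  · rw [sign_neg hlt, sign_neg (hx'.2 u hu hlt)]
  · rw [sign_pos hgt, sign_pos (hx'.1 u hu hgt)]

/-- The chambers are the maximal cells of the arrangement. -/
theorem mem_chamberSet_iff (hP : IsFullPolytope P) (F : ArrangementCell P) :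
    F.1 ∈ chamberSet (facetNormals P) (supportFn P) ↔
      ∀ G : ArrangementCell P, F.IsFaceOf G → G = F := by
  constructor
  · rintro ⟨x, hx⟩ G hFG
    exact Subtype.ext (funext fun u => ((hFG u).resolve_left (hx u).2).symm)
  · intro hmax
    obtain ⟨x, hx⟩ := F.2
    obtain ⟨x', hx'⟩ := exists_sign_ne_zero (finite_facetNormals hP)
      (fun u hu => ne_zero_of_mem_facetNormals hu) (supportFn P) x
    have hG := hmax ⟨positionVector P x', x', rfl⟩ (fun u => by
      by_cases h0 : inner ℝ (u : EuclideanSpace ℝ (Fin n)) x - supportFn P u = 0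
      · left
        rw [← hx]
        simp [positionVector, h0]
      · right
        rw [← hx]
        exact ((hx' u u.2).2 h0).symm)
    rw [← hG]
    exact ⟨x', fun u => ⟨rfl, fun h0 => (hx' u u.2).1 (sign_eq_zero_iff.1 h0)⟩⟩

theorem card_maximal_eq_ncard_chamberSet (hP : IsFullPolytope P) :
    Nat.card {F : ArrangementCell P // ∀ G : ArrangementCell P, F.IsFaceOf G → G = F} =
      (chamberSet (facetNormals P) (supportFn P)).ncard := by
  rw [← Nat.card_coe_set_eq]
  refine Nat.card_congr (Equiv.ofBijective (fun F => ⟨F.1.1, (mem_chamberSet_iff hP F.1).2 F.2⟩)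
    ⟨fun F G h => ?_, fun σ => ?_⟩)
  · have h1 : F.1.1 = G.1.1 := Subtype.mk.inj h
    exact Subtype.ext (Subtype.ext h1)
  · obtain ⟨x, hx⟩ := σ.2
    have hcell : σ.1 ∈ Set.range (positionVector P) := ⟨x, funext fun u => (hx u).1.symm⟩
    exact ⟨⟨⟨σ.1, hcell⟩, (mem_chamberSet_iff hP ⟨σ.1, hcell⟩).1 σ.2⟩, rfl⟩

/-- A bijection preserving the face relation in both directions preserves maximal cells. The number
of chambers is the only consequence of combinatorial equivalence used in the count. -/
theorem ArrangementsEquivalent.ncard_chamberSet_eq (hP : IsFullPolytope P) (hQ : IsFullPolytope Q)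
    (h : ArrangementsEquivalent P Q) :
    (chamberSet (facetNormals P) (supportFn P)).ncard =
      (chamberSet (facetNormals Q) (supportFn Q)).ncard := by
  obtain ⟨e, he⟩ := h
  rw [← card_maximal_eq_ncard_chamberSet hP, ← card_maximal_eq_ncard_chamberSet hQ]
  refine Nat.card_congr (e.subtypeEquiv fun F => ⟨fun hF G hG => ?_, fun hF G hG => ?_⟩)
  · rw [← e.apply_symm_apply G] at hG ⊢
    rw [hF _ ((he _ _).1 hG)]
  · exact e.injective (hF _ ((he _ _).2 hG))

theorem chamberSet_congr {N : Set (EuclideanSpace ℝ (Fin n))}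
    {h h' : EuclideanSpace ℝ (Fin n) → ℝ} (hh : ∀ u ∈ N, h u = h' u) :
    chamberSet N h = chamberSet N h' := by
  ext σ
  refine exists_congr fun x => forall_congr' fun u => ?_
  rw [hh u u.2]

theorem IsStronglyMonotypic.ncard_chamberSet_eq (hP : IsStronglyMonotypic P)
    (hQ : IsFullPolytope Q) (hN : facetNormals Q = facetNormals P) :
    (chamberSet (facetNormals P) (supportFn Q)).ncard =
      (chamberSet (facetNormals P) (supportFn P)).ncard := by
  rw [(hP.2 Q hQ hN).ncard_chamberSet_eq hP.1 hQ, hN]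

/-- A sign vector `-sign c` on the support of a circuit `c` is realized when `∑ c u * h u > 0`. -/
theorem exists_mem_chamberSet_of_circuit {N : Finset (EuclideanSpace ℝ (Fin n))}
    (hN0 : ∀ u ∈ N, u ≠ 0) {c h : EuclideanSpace ℝ (Fin n) → ℝ} (hc : IsCircuit id N c)
    (hpos : 0 < ∑ u ∈ N, c u * h u) :
    ∃ σ ∈ chamberSet (N : Set (EuclideanSpace ℝ (Fin n))) h,
      ∀ u : (N : Set (EuclideanSpace ℝ (Fin n))), c u ≠ 0 → σ u = -SignType.sign (c u) := by
  classical
  set S := ∑ u ∈ N, c u * c u with hS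
  have hS0 : 0 < S := by
    obtain ⟨e, he⟩ := hc.ne_zero
    exact Finset.sum_pos' (fun u _ => mul_self_nonneg _)
      ⟨e, hc.mem he, mul_self_pos.2 he⟩
  set φ := ∑ u ∈ N, c u * h u with hφ
  -- The shift by a multiple of `c` makes the prescribed values satisfy the relation, and puts `x`
  -- on the side `-sign (c u)` of each hyperplane of the support.
  obtain ⟨x, hx⟩ := hc.exists_inner_eq (t := fun u => h u - φ / S * c u) (by
    have : ∀ u, c u * (h u - φ / S * c u) = c u * h u - φ / S * (c u * c u) := fun u => by ring
    simp only [this, Finset.sum_sub_distrib, ← Finset.mul_sum, ← hS, ← hφ]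
    rw [div_mul_cancel₀ _ hS0.ne', sub_self])
  obtain ⟨x', hx'⟩ := exists_sign_ne_zero (N := N) N.finite_toSet hN0 h x
  refine ⟨fun u => SignType.sign (inner ℝ (u : EuclideanSpace ℝ (Fin n)) x' - h u),
    ⟨x', fun u => ⟨rfl, fun h0 => (hx' u u.2).1 (sign_eq_zero_iff.1 h0)⟩⟩, fun u hu => ?_⟩
  have h1 : inner ℝ (u : EuclideanSpace ℝ (Fin n)) x - h u = -(φ / S) * c u := by
    rw [hx u hu]; ring
  have h2 : -(φ / S) < 0 := neg_neg_of_pos (div_pos hpos hS0)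
  show SignType.sign (inner ℝ (u : EuclideanSpace ℝ (Fin n)) x' - h u) = _
  rw [(hx' u u.2).2 (by rw [h1]; exact mul_ne_zero h2.ne hu), h1, sign_mul, sign_neg h2]
  simp

/-- A point strictly off all hyperplanes keeps its signs under small perturbations, and there are
only finitely many chambers. -/
theorem eventually_chamberSet_subset {N : Set (EuclideanSpace ℝ (Fin n))} (hN : N.Finite)
    (h g : EuclideanSpace ℝ (Fin n) → ℝ) :
    ∀ᶠ t : ℝ in nhds 0, chamberSet N h ⊆ chamberSet N (fun u => h u + t * g u) := by
  have : Finite N := hN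
  refine (Filter.eventually_all_finite (Set.toFinite (chamberSet N h))).2 fun σ hσ => ?_
  obtain ⟨x, hx⟩ := hσ
  have hev : ∀ᶠ t : ℝ in nhds 0, ∀ u : N,
      SignType.sign (inner ℝ (u : EuclideanSpace ℝ (Fin n)) x - (h u + t * g u)) =
        SignType.sign (inner ℝ (u : EuclideanSpace ℝ (Fin n)) x - h u) := by
    refine Filter.eventually_all.2 fun u => ?_
    have hcont : Continuous (fun t : ℝ =>
        inner ℝ (u : EuclideanSpace ℝ (Fin n)) x - (h u + t * g u)) := by fun_prop
    have ht := hcont.tendsto 0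
    simp only [zero_mul, add_zero] at ht
    have hne : inner ℝ (u : EuclideanSpace ℝ (Fin n)) x - h u ≠ 0 := fun h0 =>
      (hx u).2 (by rw [(hx u).1, h0, sign_zero])
    rcases lt_or_gt_of_ne hne with hlt | hgt
    · filter_upwards [ht.eventually (gt_mem_nhds hlt)] with t h1
      rw [sign_neg h1, sign_neg hlt]
    · filter_upwards [ht.eventually (lt_mem_nhds hgt)] with t h1
      rw [sign_pos h1, sign_pos hgt]
  filter_upwards [hev] with t ht
  exact ⟨x, fun u => ⟨by rw [(hx u).1, ht u], (hx u).2⟩⟩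

end Chambers

/-! ### Sign conditions on circuits of a strongly monotypic polytope -/

section Monotypic

variable {n : ℕ} {P Q : Set (EuclideanSpace ℝ (Fin n))}

theorem IsStronglyMonotypic.of_facetNormals_eq (hP : IsStronglyMonotypic P)
    (hQ : IsFullPolytope Q) (hN : facetNormals Q = facetNormals P) : IsStronglyMonotypic Q := by
  refine ⟨hQ, fun R hR hRN => ?_⟩
  obtain ⟨e, he⟩ := hP.2 Q hQ hN
  obtain ⟨f, hf⟩ := hP.2 R hR (hRN.trans hN)
  refine ⟨e.symm.trans f, fun F G => ?_⟩
  rw [Equiv.trans_apply, Equiv.trans_apply, hf, ← he, e.apply_symm_apply, e.apply_symm_apply]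

/-- For a strongly monotypic polytope, the facet hyperplanes whose normals form a circuit have no
point in common. -/
theorem IsStronglyMonotypic.sum_mul_supportFn_ne_zero (hP : IsStronglyMonotypic P)
    {N : Finset (EuclideanSpace ℝ (Fin n))}
    (hN : (N : Set (EuclideanSpace ℝ (Fin n))) = facetNormals P)
    {c : EuclideanSpace ℝ (Fin n) → ℝ} (hc : IsCircuit id N c) :
    ∑ u ∈ N, c u * supportFn P u ≠ 0 := by
  intro hzero
  wlog hpos : ∃ u v, u ≠ v ∧ 0 < c u ∧ 0 < c v generalizing c
  · have hmem : ∀ u ∈ N, u ∈ facetNormals P := fun u hu => hN ▸ Finset.mem_coe.2 hu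
    obtain ⟨u, v, huv, hmul⟩ := hc.exists_ne_mul_pos (fun u hu => (hmem u hu).1)
    rcases pos_and_pos_or_neg_and_neg_of_mul_pos hmul with h | h
    · exact hpos ⟨u, v, huv, h⟩
    · exact this hc.neg (by simpa using hzero)
        ⟨u, v, huv, neg_pos.2 h.1, neg_pos.2 h.2⟩
  have hmem : ∀ u ∈ N, u ∈ facetNormals P := fun u hu => hN ▸ Finset.mem_coe.2 hu
  have hN0 : ∀ u ∈ N, u ≠ 0 := fun u hu => ne_zero_of_mem_facetNormals (hmem u hu)
  obtain ⟨u₁, v₁, huv, hu₁, hv₁⟩ := hpos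
  obtain ⟨y, hy⟩ := hc.exists_segment_pos huv hu₁ hv₁
  have hev := ((eventually_chamberSet_subset (finite_facetNormals hP.1) (supportFn P)
    (fun u => max (inner ℝ u y) 0)).filter_mono
      (nhdsWithin_le_nhds (s := Set.Ioi (0 : ℝ)))).and self_mem_nhdsWithin
  obtain ⟨t, hsub, ht⟩ := hev.exists
  have ht0 : (0 : ℝ) < t := ht
  obtain ⟨Q, hQ, hQN, hQh⟩ := exists_polytope_add_segment hP.1 (t • y)
  have hQh' : ∀ u ∈ facetNormals P, supportFn Q u = supportFn P u + t * max (inner ℝ u y) 0 := by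
    intro u hu
    rw [hQh u hu, real_inner_smul_right, mul_max_of_nonneg _ _ ht0.le, mul_zero]
  have hcard := hP.ncard_chamberSet_eq hQ hQN
  rw [chamberSet_congr hQh'] at hcard
  have hpos : 0 < ∑ u ∈ N, c u * (supportFn P u + t * max (inner ℝ u y) 0) := by
    have : ∀ u, c u * (supportFn P u + t * max (inner ℝ u y) 0) =
      c u * supportFn P u + t * (c u * max (inner ℝ u y) 0) := fun u => by ring
    simp only [this, Finset.sum_add_distrib, ← Finset.mul_sum, hzero, zero_add]
    exact mul_pos ht0 hy
  obtain ⟨σ, hσ, hσc⟩ := exists_mem_chamberSet_of_circuit hN0 hc hpos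
  have hfinN : Finite (facetNormals P) := finite_facetNormals hP.1
  rw [← hN] at hsub hcard hfinN
  have heq := Set.eq_of_subset_of_ncard_le hsub hcard.le (Set.toFinite _)
  rw [← heq] at hσ
  obtain ⟨x, hx⟩ := hσ
  -- Equal counts make the new sign vector a chamber of the original arrangement. There all terms
  -- over the support of `c` are negative, while their sum is zero.
  have hneg : ∀ u ∈ N, c u ≠ 0 → c u * (inner ℝ u x - supportFn P u) < 0 := by
    intro u hu hcu
    have h1 := (hx ⟨u, hu⟩).1
    rw [hσc ⟨u, hu⟩ hcu] at h1
    simp only at h1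
    rcases lt_or_gt_of_ne hcu with hlt | hgt
    · rw [sign_neg hlt, neg_neg, eq_comm, sign_eq_one_iff] at h1
      exact mul_neg_of_neg_of_pos hlt h1
    · rw [sign_pos hgt, eq_comm, sign_eq_neg_one_iff] at h1
      exact mul_neg_of_pos_of_neg hgt h1
  have hsum : ∑ u ∈ N, c u * (inner ℝ u x - supportFn P u) < 0 := by
    refine Finset.sum_neg' (fun u hu => ?_) ⟨u₁, hc.mem hu₁.ne', hneg u₁ (hc.mem hu₁.ne') hu₁.ne'⟩
    by_cases hcu : c u = 0
    · simp [hcu]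
    · exact (hneg u hu hcu).le
  simp only [mul_sub, Finset.sum_sub_distrib, hzero, hc.sum_inner x] at hsum
  simp at hsum

/-- The normals of a strongly monotypic polytope: no circuit has two positive and two negative
coefficients. -/
theorem IsStronglyMonotypic.circuit_signs (hP : IsStronglyMonotypic P)
    {N : Finset (EuclideanSpace ℝ (Fin n))}
    (hN : (N : Set (EuclideanSpace ℝ (Fin n))) = facetNormals P)
    {c : EuclideanSpace ℝ (Fin n) → ℝ} (hc : IsCircuit id N c) :
    (∀ u v, 0 < c u → 0 < c v → u = v) ∨ (∀ u v, c u < 0 → c v < 0 → u = v) := by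
  by_contra hcon
  push Not at hcon
  obtain ⟨⟨u₁, v₁, hu₁, hv₁, hne₁⟩, ⟨u₂, v₂, hu₂, hv₂, hne₂⟩⟩ := hcon
  wlog hneg : ∑ u ∈ N, c u * supportFn P u < 0 generalizing c u₁ v₁ u₂ v₂
  · have hne := hP.sum_mul_supportFn_ne_zero hN hc
    refine this hc.neg u₂ v₂ (neg_pos.2 hu₂) (neg_pos.2 hv₂) hne₂ u₁ v₁ (neg_neg_of_pos hu₁)
      (neg_neg_of_pos hv₁) hne₁ ?_
    have := lt_of_le_of_ne (not_lt.1 hneg) hne.symm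
    simpa using this
  obtain ⟨y, hy⟩ := hc.exists_segment_pos hne₁ hu₁ hv₁
  set φ := ∑ w ∈ N, c w * max (inner ℝ w y) 0 with hφ
  -- The length at which the added segment brings the circuit sum exactly to zero.
  set t := -(∑ u ∈ N, c u * supportFn P u) / φ with ht
  have ht0 : 0 < t := div_pos (neg_pos.2 hneg) hy
  obtain ⟨Q, hQ, hQN, hQh⟩ := exists_polytope_add_segment hP.1 (t • y)
  refine (hP.of_facetNormals_eq hQ hQN).sum_mul_supportFn_ne_zero (hN.trans hQN.symm) hc ?_
  have : ∀ u ∈ N, c u * supportFn Q u =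
      c u * supportFn P u + t * (c u * max (inner ℝ u y) 0) := fun u hu => by
    rw [hQh u (hN ▸ Finset.mem_coe.2 hu), real_inner_smul_right]
    have h1 : max (t * inner ℝ u y) 0 = t * max (inner ℝ u y) 0 := by
      rw [mul_max_of_nonneg _ _ ht0.le, mul_zero]
    rw [h1]; ring
  rw [Finset.sum_congr rfl this, Finset.sum_add_distrib, ← Finset.mul_sum, ← hφ, ht,
    div_mul_cancel₀ _ hy.ne', add_neg_cancel]

/-- The normals of the facets through a point are linearly independent. -/
theorem IsStronglyMonotypic.active_independent (hP : IsStronglyMonotypic P)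
    {N : Finset (EuclideanSpace ℝ (Fin n))}
    (hN : (N : Set (EuclideanSpace ℝ (Fin n))) = facetNormals P)
    {x : EuclideanSpace ℝ (Fin n)} {c : EuclideanSpace ℝ (Fin n) → ℝ} (hc : IsRelation id N c)
    (hx : ∀ u, c u ≠ 0 → inner ℝ u x = supportFn P u) (u : EuclideanSpace ℝ (Fin n)) :
    c u = 0 := by
  by_contra hu
  -- The support of `d` lies in that of `c`, so all its hyperplanes pass through `x`, contrary to
  -- the nonvanishing of circuit sums.
  obtain ⟨d, hd, hdc, -⟩ := hc.exists_conformal_circuit hu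
  refine hP.sum_mul_supportFn_ne_zero hN hd ?_
  rw [← hd.sum_inner x]
  refine Finset.sum_congr rfl fun w _ => ?_
  by_cases hw : c w = 0
  · simp [hdc.eq_zero hw]
  · rw [hx w hw]

end Monotypic

/-! ### Block families: independent simplices around the origin -/

/-- The finite set `U`, partitioned into blocks by the label `p`, carries positive weights `α` such
that the relations between the elements of `U` are exactly the combinations of the weights of the
blocks. Each block is the vertex set of a simplex around `0`, and the spans are independent. -/
structure IsBlockFamily {E κ : Type*} [AddCommGroup E] [Module ℝ E] (U : Finset E) (p : E → κ)
    (α : E → ℝ) : Prop where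
  pos : ∀ u ∈ U, 0 < α u
  sum_eq : ∀ t : κ → ℝ, ∑ u ∈ U, (t (p u) * α u) • u = 0
  exists_eq : ∀ c, IsRelation id U c → ∃ t : κ → ℝ, ∀ u ∈ U, c u = t (p u) * α u

section Blocks

variable {E κ : Type*} [AddCommGroup E] [Module ℝ E] {U : Finset E} {p : E → κ} {α : E → ℝ}

theorem IsBlockFamily.eq_zero_of_relation (hU : IsBlockFamily U p α) {c : E → ℝ}
    (hc : IsRelation id U c) (hz : ∀ u ∈ U, ∃ w ∈ U, p w = p u ∧ c w = 0) (u : E) : c u = 0 := by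
  by_cases hu : u ∈ U
  · obtain ⟨t, ht⟩ := hU.exists_eq c hc
    obtain ⟨w, hw, hpw, hcw⟩ := hz u hu
    have h1 := ht w hw
    rw [hcw, hpw, eq_comm, mul_eq_zero] at h1
    rw [ht u hu, h1.resolve_right (hU.pos w hw).ne', zero_mul]
  · exact hc.supp u hu

/-- Every vector of the span is a nonnegative combination that omits a vector of each block. -/
theorem IsBlockFamily.exists_nonneg_combination (hU : IsBlockFamily U p α) {l : E}
    (hl : l ∈ Submodule.span ℝ (U : Set E)) :
    ∃ γ : E → ℝ, (∀ u, u ∉ U → γ u = 0) ∧ (∀ u, 0 ≤ γ u) ∧ ∑ u ∈ U, γ u • u = l ∧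
      ∀ u ∈ U, ∃ w ∈ U, p w = p u ∧ γ w = 0 := by
  classical
  obtain ⟨c, -, hc⟩ := Submodule.mem_span_finset.1 hl
  -- `r k` is the least ratio `c u / α u` on block `k`. Subtracting `r k` times the block's relation
  -- makes the coefficients nonnegative and one of them zero. Labels of empty blocks get the
  -- irrelevant value `0`.
  have hr : ∀ k : κ, ∃ r : ℝ, (∀ u ∈ U, p u = k → r ≤ c u / α u) ∧
      ((∃ u ∈ U, p u = k) → ∃ u ∈ U, p u = k ∧ r = c u / α u) := by
    intro k
    by_cases hk : (U.filter (fun u => p u = k)).Nonempty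
    · obtain ⟨w, hw, hmin⟩ := Finset.exists_min_image _ (fun u => c u / α u) hk
      rw [Finset.mem_filter] at hw
      exact ⟨c w / α w, fun u hu hp => hmin u (Finset.mem_filter.2 ⟨hu, hp⟩),
        fun _ => ⟨w, hw.1, hw.2, rfl⟩⟩
    · have hno : ∀ u ∈ U, p u ≠ k := fun u hu hp => hk ⟨u, Finset.mem_filter.2 ⟨hu, hp⟩⟩
      exact ⟨0, fun u hu hp => absurd hp (hno u hu), fun ⟨u, hu, hp⟩ => absurd hp (hno u hu)⟩
  choose r hr1 hr2 using hr
  refine ⟨fun u => if u ∈ U then c u - r (p u) * α u else 0, fun u hu => by simp [hu],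
    fun u => ?_, ?_, fun u hu => ?_⟩
  · by_cases hu : u ∈ U
    · have := hr1 (p u) u hu rfl
      rw [le_div_iff₀ (hU.pos u hu)] at this
      simp [hu, this]
    · simp [hu]
  · rw [← hc, ← sub_zero (∑ u ∈ U, c u • u), ← hU.sum_eq r, ← Finset.sum_sub_distrib]
    refine Finset.sum_congr rfl fun u hu => ?_
    simp only [hu, if_true, sub_smul]
  · obtain ⟨w, hw, hpw, hrw⟩ := hr2 (p u) ⟨u, hu, rfl⟩
    refine ⟨w, hw, hpw, ?_⟩
    simp only [hw, if_true]
    rw [hpw, hrw, div_mul_cancel₀ _ (hU.pos w hw).ne', sub_self]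

/-- `A` becomes a block under an unused label, which exists because `κ` is infinite. By `hmin`, a
relation on `U ∪ A` restricts to a multiple of `d` on `A`, hence also to a relation on `U`. -/
theorem IsBlockFamily.exists_insert [Infinite κ] [DecidableEq E] (hU : IsBlockFamily U p α)
    {A : Finset E}
    (hA : ∀ u ∈ A, u ∉ Submodule.span ℝ (U : Set E)) {d : E → ℝ} (hd : ∀ u ∈ A, 0 < d u)
    (hsum : ∑ u ∈ A, d u • u = 0)
    (hmin : ∀ g : E → ℝ, ∑ u ∈ A, g u • u ∈ Submodule.span ℝ (U : Set E) →
      ∃ s : ℝ, ∀ u ∈ A, g u = s * d u) :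
    ∃ (p' : E → κ) (α' : E → ℝ), IsBlockFamily (U ∪ A) p' α' := by
  classical
  obtain ⟨m, hm⟩ := Infinite.exists_notMem_finset (U.image p)
  have hAU : ∀ u ∈ A, u ∉ U := fun u hu hu' => hA u hu (Submodule.subset_span hu')
  have hdisj : Disjoint U A := Finset.disjoint_right.2 hAU
  refine ⟨fun u => if u ∈ U then p u else m, fun u => if u ∈ U then α u else d u, ?_, ?_, ?_⟩
  · intro u hu
    by_cases hu' : u ∈ U
    · simpa [hu'] using hU.pos u hu'
    · simpa [hu'] using hd u ((Finset.mem_union.1 hu).resolve_left hu')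
  · intro t
    rw [Finset.sum_union hdisj]
    have h1 : ∀ u ∈ U, (t (if u ∈ U then p u else m) * if u ∈ U then α u else d u) • u =
      (t (p u) * α u) • u := fun u hu => by simp [hu]
    have h2 : ∀ u ∈ A, (t (if u ∈ U then p u else m) * if u ∈ U then α u else d u) • u =
      t m • d u • u := fun u hu => by simp [hAU u hu, mul_smul]
    rw [Finset.sum_congr rfl h1, Finset.sum_congr rfl h2, ← Finset.smul_sum, hsum, hU.sum_eq]
    simp
  · intro c hc
    have hcs := hc.sum_eq
    simp only [id] at hcs
    rw [Finset.sum_union hdisj] at hcs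
    obtain ⟨s, hs⟩ := hmin c (by
      rw [eq_neg_of_add_eq_zero_right hcs]
      exact neg_mem (Submodule.sum_mem _ fun u hu =>
        Submodule.smul_mem _ _ (Submodule.subset_span hu)))
    have hA0 : ∑ u ∈ A, c u • u = 0 := by
      rw [Finset.sum_congr rfl fun u hu => by rw [hs u hu, mul_smul], ← Finset.smul_sum, hsum,
        smul_zero]
    obtain ⟨t, ht⟩ := hU.exists_eq (fun u => if u ∈ U then c u else 0)
      ⟨fun u hu => by simp [hu], by
        rw [hA0, add_zero] at hcs
        rw [← hcs]
        exact Finset.sum_congr rfl fun u hu => by simp [hu]⟩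
    refine ⟨Function.update t m s, fun u hu => ?_⟩
    by_cases hu' : u ∈ U
    · have hpm : p u ≠ m := fun h => hm (h ▸ Finset.mem_image_of_mem p hu')
      simpa [hu', hpm] using ht u hu'
    · simpa [hu'] using hs u ((Finset.mem_union.1 hu).resolve_left hu')

/-- Substituting `x = ν⁻¹ • ∑ d u • u` into the relation of the block of `x` gives the new weights
`α x / ν * d u` on `A`. Conversely, by `hmin`, a relation on the new set collapses to one on `U`. -/
theorem IsBlockFamily.exists_replace [DecidableEq E] (hU : IsBlockFamily U p α) {A : Finset E}
    (hA : ∀ u ∈ A, u ∉ Submodule.span ℝ (U : Set E)) {d : E → ℝ} (hd : ∀ u ∈ A, 0 < d u)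
    {x : E} (hx : x ∈ U) {ν : ℝ} (hν : 0 < ν) (hsum : ∑ u ∈ A, d u • u = ν • x)
    (hmin : ∀ g : E → ℝ, ∑ u ∈ A, g u • u ∈ Submodule.span ℝ (U : Set E) →
      ∃ s : ℝ, ∀ u ∈ A, g u = s * d u) :
    ∃ (p' : E → κ) (α' : E → ℝ), IsBlockFamily (U.erase x ∪ A) p' α' := by
  classical
  have hAU : ∀ u ∈ A, u ∉ U := fun u hu hu' => hA u hu (Submodule.subset_span hu')
  have hdisj : Disjoint (U.erase x) A :=
    Finset.disjoint_right.2 fun u hu h => hAU u hu (Finset.mem_of_mem_erase h)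
  refine ⟨fun u => if u ∈ U then p u else p x,
    fun u => if u ∈ U then α u else α x / ν * d u, ?_, ?_, ?_⟩
  · intro u hu
    by_cases hu' : u ∈ U
    · simpa [hu'] using hU.pos u hu'
    · have huA : u ∈ A := (Finset.mem_union.1 hu).resolve_left
        fun h => hu' (Finset.mem_of_mem_erase h)
      simpa [hu'] using mul_pos (div_pos (hU.pos x hx) hν) (hd u huA)
  · intro t
    rw [Finset.sum_union hdisj]
    have h1 : ∀ u ∈ U.erase x, (t (if u ∈ U then p u else p x) *
        if u ∈ U then α u else α x / ν * d u) • u = (t (p u) * α u) • u := fun u hu => by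
      simp [Finset.mem_of_mem_erase hu]
    have h2 : ∀ u ∈ A, (t (if u ∈ U then p u else p x) *
        if u ∈ U then α u else α x / ν * d u) • u = (t (p x) * (α x / ν)) • d u • u :=
      fun u hu => by simp [hAU u hu, mul_smul]
    rw [Finset.sum_congr rfl h1, Finset.sum_congr rfl h2, ← Finset.smul_sum, hsum, smul_smul,
      mul_assoc, div_mul_cancel₀ _ hν.ne', Finset.sum_erase_add _ _ hx, hU.sum_eq]
  · intro c hc
    have hcs := hc.sum_eq
    simp only [id] at hcs
    rw [Finset.sum_union hdisj] at hcs
    obtain ⟨s, hs⟩ := hmin c (by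
      rw [eq_neg_of_add_eq_zero_right hcs]
      exact neg_mem (Submodule.sum_mem _ fun u hu =>
        Submodule.smul_mem _ _ (Submodule.subset_span (Finset.mem_of_mem_erase hu))))
    have hAs : ∑ u ∈ A, c u • u = (s * ν) • x := by
      rw [Finset.sum_congr rfl fun u hu => by rw [hs u hu, mul_smul], ← Finset.smul_sum, hsum,
        mul_smul]
    obtain ⟨t, ht⟩ := hU.exists_eq
      (fun u => if u ∈ U then if u = x then s * ν else c u else 0)
      ⟨fun u hu => by simp [hu], by
        rw [← Finset.sum_erase_add _ _ hx, ← hcs, hAs]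
        congr 1
        · refine Finset.sum_congr rfl fun u hu => ?_
          simp [Finset.mem_of_mem_erase hu, Finset.ne_of_mem_erase hu]
        · simp [hx]⟩
    have htx := ht x hx
    simp only [hx, if_true] at htx
    refine ⟨t, fun u hu => ?_⟩
    by_cases hu' : u ∈ U
    · have hux : u ≠ x := by
        rintro rfl
        rcases Finset.mem_union.1 hu with h | h
        · exact Finset.notMem_erase _ _ h
        · exact hAU _ h hx
      simpa [hu', hux] using ht u hu'
    · have huA : u ∈ A := (Finset.mem_union.1 hu).resolve_left
        fun h => hu' (Finset.mem_of_mem_erase h)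
      simp only [hu', if_false]
      rw [hs u huA, ← mul_assoc, mul_div_assoc', ← htx, mul_div_cancel_right₀ _ hν.ne']

end Blocks

/-! ### Enlarging a block family until it spans -/

section Extension

variable {E : Type*} [NormedAddCommGroup E] [InnerProductSpace ℝ E] [FiniteDimensional ℝ E]

/-- If only `0` makes a nonacute angle with all of `N`, then modulo every proper subspace `L` there
is a nonzero nonnegative relation between the elements of `N` not in `L`. -/
theorem exists_nonneg_relation_mkQ {N : Finset E}
    (hN : ∀ d : E, (∀ u ∈ N, inner ℝ u d ≤ 0) → d = 0) {L : Submodule ℝ E} (hL : L ≠ ⊤)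
    [DecidablePred (· ∉ L)] :
    ∃ c : E → ℝ, IsRelation L.mkQ (N.filter (· ∉ L)) c ∧ (∀ u, 0 ≤ c u) ∧ ∃ e, c e ≠ 0 := by
  classical
  set N' := N.filter (· ∉ L) with hN'
  by_cases hmeet : ∃ x ∈ convexHull ℝ (N' : Set E), x ∈ L
  · obtain ⟨x, hx, hxL⟩ := hmeet
    obtain ⟨w, hw0, hw1, hwx⟩ := Finset.mem_convexHull'.1 hx
    refine ⟨fun u => if u ∈ N' then w u else 0, ⟨fun u hu => by simp [hu], ?_⟩, fun u => ?_, ?_⟩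
    · have h1 : ∑ u ∈ N', (if u ∈ N' then w u else 0) • L.mkQ u = L.mkQ (∑ u ∈ N', w u • u) := by
        rw [map_sum]
        exact Finset.sum_congr rfl fun u hu => by rw [if_pos hu, map_smul]
      rw [h1, hwx, Submodule.mkQ_apply, Submodule.Quotient.mk_eq_zero]
      exact hxL
    · dsimp only
      split_ifs with hu
      · exact hw0 u hu
      · exact le_rfl
    · by_contra! hz
      rw [Finset.sum_eq_zero fun u hu => by simpa [hu] using hz u] at hw1
      exact zero_ne_one hw1
  · exfalso
    by_cases hne : N'.Nonempty
    · obtain ⟨f, a, b, hfa, hab, hfb⟩ := geometric_hahn_banach_compact_closed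
        (convex_convexHull ℝ (N' : Set E)) (N'.finite_toSet.isCompact_convexHull (𝕜 := ℝ)) L.convex
        L.closed_of_finiteDimensional
        (Set.disjoint_left.2 fun x hx hxL => hmeet ⟨x, hx, hxL⟩)
      -- A functional bounded below on a subspace vanishes there.
      have hfL : ∀ x ∈ L, f x = 0 := by
        intro x hx
        by_contra h0
        have h1 := hfb ((b / f x) • x) (L.smul_mem _ hx)
        rw [map_smul, smul_eq_mul, div_mul_cancel₀ _ h0] at h1
        exact lt_irrefl _ h1
      have ha0 : a < 0 := by
        have := hfb 0 L.zero_mem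
        rw [map_zero] at this
        exact hab.trans this
      set d := (InnerProductSpace.toDual ℝ E).symm f with hd
      have hfd : ∀ x, f x = inner ℝ x d := fun x => by
        rw [real_inner_comm, hd, InnerProductSpace.toDual_symm_apply]
      have hneg : ∀ u ∈ N', f u < 0 := fun u hu => (hfa u (subset_convexHull ℝ _ hu)).trans ha0
      have hd0 := hN d fun u hu => by
        rw [← hfd]
        by_cases huL : u ∈ L
        · exact (hfL u huL).le
        · exact (hneg u (Finset.mem_filter.2 ⟨hu, huL⟩)).le
      obtain ⟨u, hu⟩ := hne
      have := hneg u hu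
      rw [hfd, hd0, inner_zero_right] at this
      exact lt_irrefl _ this
    · have hNL : ∀ u ∈ N, u ∈ L := fun u hu => by
        by_contra huL
        exact hne ⟨u, Finset.mem_filter.2 ⟨hu, huL⟩⟩
      refine hL (Submodule.orthogonal_eq_bot_iff.1 ((Submodule.eq_bot_iff _).2 fun d hd => ?_))
      exact hN d fun u hu => ((Submodule.mem_orthogonal L d).1 hd u (hNL u hu)).le

/-- A block family that does not span can be enlarged, if no circuit of `N` has two positive and
two negative coefficients. -/
theorem IsBlockFamily.exists_span_lt [DecidableEq E] {κ : Type*} [Infinite κ] {N : Finset E}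
    (hN : ∀ d : E, (∀ u ∈ N, inner ℝ u d ≤ 0) → d = 0)
    (hsign : ∀ c, IsCircuit id N c →
      (∀ u v, 0 < c u → 0 < c v → u = v) ∨ (∀ u v, c u < 0 → c v < 0 → u = v))
    {U : Finset E} {p : E → κ} {α : E → ℝ} (hU : IsBlockFamily U p α) (hUN : U ⊆ N)
    (hspan : Submodule.span ℝ (U : Set E) ≠ ⊤) :
    ∃ (U' : Finset E) (p' : E → κ) (α' : E → ℝ), IsBlockFamily U' p' α' ∧ U' ⊆ N ∧
      Submodule.span ℝ (U : Set E) < Submodule.span ℝ (U' : Set E) := by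
  classical
  set L := Submodule.span ℝ (U : Set E) with hL
  have hUL : ∀ u ∈ U, u ∈ L := fun u hu => Submodule.subset_span hu
  obtain ⟨c, hc, hc0, e, hce⟩ := exists_nonneg_relation_mkQ hN hspan
  obtain ⟨d, hd, hdc, hde⟩ := hc.exists_conformal_circuit hce
  set N' := N.filter (· ∉ L) with hN'
  have hd0 : ∀ u, 0 ≤ d u := fun u => by
    by_contra h
    exact absurd ((hdc u).2 (not_le.1 h)) (not_lt.2 (hc0 u))
  have hdL : ∀ u ∈ L, d u = 0 := fun u hu => hd.supp u (by simp [hN', hu])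
  set A := N'.filter (fun u => d u ≠ 0) with hA
  have hAN : A ⊆ N := (Finset.filter_subset _ _).trans (Finset.filter_subset _ _)
  have hAL : ∀ u ∈ A, u ∉ L := fun u hu =>
    (Finset.mem_filter.1 (Finset.mem_filter.1 hu).1).2
  have hAd : ∀ u ∈ A, 0 < d u := fun u hu =>
    lt_of_le_of_ne (hd0 u) (Finset.mem_filter.1 hu).2.symm
  have hdA : ∀ u, u ∉ A → d u = 0 := fun u hu => by
    by_contra h
    exact hu (Finset.mem_filter.2 ⟨hd.mem h, h⟩)
  have heA : e ∈ A := by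
    by_contra h
    exact hde (hdA e h)
  have hmin : ∀ g : E → ℝ, ∑ u ∈ A, g u • u ∈ L → ∃ s : ℝ, ∀ u ∈ A, g u = s * d u := by
    intro g hg
    obtain ⟨s, hs⟩ := hd.eq_smul (fun u => if u ∈ A then g u else 0) (by
      refine IsRelation.mono (N := A) ⟨fun u hu => by simp [hu], ?_⟩ (Finset.filter_subset _ _)
      rw [← (Submodule.Quotient.mk_eq_zero L).2 hg, ← Submodule.mkQ_apply, map_sum]
      exact Finset.sum_congr rfl fun u hu => by rw [if_pos hu, map_smul])
      (fun u hu => if_neg fun h => (hAd u h).ne' hu)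
    exact ⟨s, fun u hu => by simpa [hu] using hs u⟩
  set l := ∑ u ∈ A, d u • u with hl
  have hlL : l ∈ L := by
    have h1 := (hd.toIsRelation.of_supp (N := A) (Finset.filter_subset _ _) hdA).sum_eq
    rw [← Submodule.Quotient.mk_eq_zero L, ← h1, ← Submodule.mkQ_apply, hl, map_sum]
    exact Finset.sum_congr rfl fun u _ => map_smul _ _ _
  obtain ⟨γ, hγU, hγ0, hγl, hγz⟩ := hU.exists_nonneg_combination hlL
  have hsumN : ∑ u ∈ N, d u • u = l :=
    (Finset.sum_subset hAN fun u _ hu => by rw [hdA u hu, zero_smul]).symm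
  -- A relation `g` supported in the support of `d - γ` equals `s * d` on `A` by minimality modulo
  -- `L`. Then `g + s * γ` is a relation on `U` vanishing somewhere in each block, hence zero.
  have hcirc : IsCircuit id N (fun u => d u - γ u) := by
    refine ⟨⟨fun u hu => ?_, ?_⟩, ⟨e, ?_⟩, fun g hg hgs => ?_⟩
    · rw [hdA u fun h => hu (hAN h), hγU u fun h => hu (hUN h), sub_zero]
    · simp only [id, sub_smul, Finset.sum_sub_distrib]
      rw [hsumN, ← Finset.sum_subset hUN fun u _ hu => by rw [hγU u hu, zero_smul], hγl, sub_self]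
    · rw [hγU e fun h => hAL e heA (hUL e h), sub_zero]
      exact hde
    · have hgA : ∀ u, u ∉ A → u ∉ U → g u = 0 := fun u h1 h2 =>
        hgs u (by rw [hdA u h1, hγU u h2, sub_zero])
      have hdisj : Disjoint A U := Finset.disjoint_left.2 fun u h1 h2 => hAL u h1 (hUL u h2)
      have hgsum : ∑ u ∈ A, g u • u + ∑ u ∈ U, g u • u = 0 := by
        rw [← Finset.sum_union hdisj, ← hg.sum_eq]
        refine Finset.sum_subset (Finset.union_subset hAN hUN) fun u _ hu => ?_
        rw [Finset.mem_union, not_or] at hu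
        rw [hgA u hu.1 hu.2, zero_smul]
      obtain ⟨s, hs⟩ := hmin g (by
        rw [eq_neg_of_add_eq_zero_left hgsum]
        exact neg_mem (Submodule.sum_mem _ fun u hu => Submodule.smul_mem _ _ (hUL u hu)))
      have hz := hU.eq_zero_of_relation (c := fun u => if u ∈ U then g u + s * γ u else 0)
        ⟨fun u hu => by simp [hu], by
          have h1 : ∀ u ∈ U, (if u ∈ U then g u + s * γ u else 0) • id u =
              g u • u + s • γ u • u := fun u hu => by simp [hu, add_smul, mul_smul]
          have h2 : ∑ u ∈ A, g u • u = s • l := by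
            rw [hl, Finset.smul_sum]
            exact Finset.sum_congr rfl fun u hu => by rw [hs u hu, mul_smul]
          rw [Finset.sum_congr rfl h1, Finset.sum_add_distrib, ← Finset.smul_sum, hγl, ← h2,
            add_comm, hgsum]⟩ (fun u hu => by
          obtain ⟨w, hw, hpw, hγw⟩ := hγz u hu
          refine ⟨w, hw, hpw, ?_⟩
          simp [hw, hγw, hgs w (by rw [hdL w (hUL w hw), hγw, sub_zero])])
      refine ⟨s, fun u => ?_⟩
      by_cases huA : u ∈ A
      · rw [hs u huA, hγU u fun h => hAL u huA (hUL u h), sub_zero]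
      · by_cases huU : u ∈ U
        · have h1 := hz u
          simp only [huU, if_true] at h1
          rw [hdA u huA]
          linarith
        · rw [hgA u huA huU, hdA u huA, hγU u huU]
          simp
  have hγu : ∀ u v, γ u ≠ 0 → γ v ≠ 0 → u = v := by
    intro u v hu hv
    have hneg : ∀ w, γ w ≠ 0 → d w - γ w < 0 := fun w hw => by
      have hwU : w ∈ U := by
        by_contra h
        exact hw (hγU w h)
      rw [hdL w (hUL w hwU)]
      simpa using lt_of_le_of_ne (hγ0 w) hw.symm
    -- A single positive coefficient would mean `A = {e}`, and then `d e • e ∈ L` would put `e` in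
    -- `L`.
    rcases hsign _ hcirc with h | h
    · exfalso
      have hposA : ∀ w ∈ A, 0 < d w - γ w := fun w hw => by
        rw [hγU w fun h => hAL w hw (hUL w h), sub_zero]
        exact hAd w hw
      have hAe : A = {e} := Finset.eq_singleton_iff_unique_mem.2
        ⟨heA, fun w hw => h w e (hposA w hw) (hposA e heA)⟩
      rw [hl, hAe, Finset.sum_singleton] at hlL
      exact hAL e heA ((L.smul_mem_iff hde).1 hlL)
    · exact h u v (hneg u hu) (hneg v hv)
  have hlt : ∀ U' : Finset E, A ⊆ U' → L ≤ Submodule.span ℝ (U' : Set E) →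
      L < Submodule.span ℝ (U' : Set E) := fun U' hAU' hle =>
    lt_of_le_of_ne hle fun h => hAL e heA (h ▸ Submodule.subset_span (hAU' heA))
  by_cases hx : ∃ x, γ x ≠ 0
  · obtain ⟨x, hx⟩ := hx
    have hxU : x ∈ U := by
      by_contra h
      exact hx (hγU x h)
    have hν : 0 < γ x := lt_of_le_of_ne (hγ0 x) hx.symm
    have hlx : l = γ x • x := by
      rw [← hγl]
      refine Finset.sum_eq_single x (fun u _ hux => ?_) fun h => absurd hxU h
      have : γ u = 0 := by
        by_contra h
        exact hux (hγu u x h hx)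
      rw [this, zero_smul]
    obtain ⟨p', α', h'⟩ := hU.exists_replace hAL hAd hxU hν hlx hmin
    refine ⟨_, p', α', h', Finset.union_subset ((Finset.erase_subset _ _).trans hUN) hAN,
      hlt _ Finset.subset_union_right (Submodule.span_le.2 fun u hu => ?_)⟩
    by_cases hux : u = x
    · subst hux
      rw [SetLike.mem_coe, ← Submodule.smul_mem_iff _ hx, ← hlx]
      exact Submodule.sum_mem _ fun w hw => Submodule.smul_mem _ _
        (Submodule.subset_span (Finset.mem_union_right _ hw))
    · exact Submodule.subset_span (Finset.mem_union_left _ (Finset.mem_erase.2 ⟨hux, hu⟩))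
  · push Not at hx
    have hl0 : l = 0 := by
      rw [← hγl]
      exact Finset.sum_eq_zero fun u _ => by rw [hx u, zero_smul]
    obtain ⟨p', α', h'⟩ := hU.exists_insert hAL hAd hl0 hmin
    exact ⟨_, p', α', h', Finset.union_subset hUN hAN, hlt _ Finset.subset_union_right
      (Submodule.span_mono (Finset.coe_subset.2 Finset.subset_union_left))⟩

/-- The empty set is a block family, and a family whose span is maximal must span everything, since
otherwise it could be enlarged. -/
theorem exists_isBlockFamily_span_eq_top {N : Finset E}
    (hN : ∀ d : E, (∀ u ∈ N, inner ℝ u d ≤ 0) → d = 0)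
    (hsign : ∀ c, IsCircuit id N c →
      (∀ u v, 0 < c u → 0 < c v → u = v) ∨ (∀ u v, c u < 0 → c v < 0 → u = v)) :
    ∃ (U : Finset E) (p : E → ℕ) (α : E → ℝ), IsBlockFamily U p α ∧ U ⊆ N ∧
      Submodule.span ℝ (U : Set E) = ⊤ := by
  classical
  have hwf : WellFoundedGT (Submodule ℝ E) := inferInstance
  obtain ⟨L, ⟨U, p, α, hU, hUN, rfl⟩, hmax⟩ := hwf.wf.has_min
    {L | ∃ (U : Finset E) (p : E → ℕ) (α : E → ℝ), IsBlockFamily U p α ∧ U ⊆ N ∧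
      Submodule.span ℝ (U : Set E) = L}
    ⟨_, ∅, fun _ => 0, fun _ => 0, ⟨by simp, by simp, by simp⟩, by simp, rfl⟩
  refine ⟨U, p, α, hU, hUN, ?_⟩
  by_contra hne
  obtain ⟨U', p', α', hU', hUN', hlt⟩ := hU.exists_span_lt hN hsign hUN hne
  exact hmax _ ⟨U', p', α', hU', hUN', rfl⟩ hlt

end Extension

/-! ### Relative interior of a simplex and positive relations -/

section Simplex

variable {E : Type*} [NormedAddCommGroup E] [NormedSpace ℝ E]

/-- For each `x ∈ S` the hull contains `-s • x` for some `s > 0`, which yields a nonnegative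
relation positive at `x`. These relations are added over all `x`. -/
theorem exists_pos_relation_of_zero_mem_intrinsicInterior {S : Finset E}
    (h : (0 : E) ∈ intrinsicInterior ℝ (convexHull ℝ (S : Set E))) :
    ∃ a : E → ℝ, (∀ u ∈ S, 0 < a u) ∧ ∑ u ∈ S, a u • u = 0 := by
  classical
  obtain ⟨y, hy, hy0⟩ := mem_intrinsicInterior.1 h
  have h0 : (0 : E) ∈ affineSpan ℝ (convexHull ℝ (S : Set E)) := hy0 ▸ y.2
  have hb : ∀ x ∈ S, ∃ b : E → ℝ, (∀ u ∈ S, 0 ≤ b u) ∧ 0 < b x ∧ ∑ u ∈ S, b u • u = 0 := by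
    intro x hx
    have hxa : x ∈ affineSpan ℝ (convexHull ℝ (S : Set E)) :=
      mem_affineSpan ℝ (subset_convexHull ℝ _ hx)
    have hline : ∀ s : ℝ, -s • x ∈ affineSpan ℝ (convexHull ℝ (S : Set E)) := fun s => by
      simpa [AffineMap.lineMap_apply] using AffineMap.lineMap_mem (-s) h0 hxa
    have hcont : Continuous
        (fun s : ℝ => (⟨-s • x, hline s⟩ : affineSpan ℝ (convexHull ℝ (S : Set E)))) :=
      Continuous.subtype_mk (by fun_prop) _
    have ht := hcont.tendsto 0
    have hy' : (⟨-(0 : ℝ) • x, hline 0⟩ : affineSpan ℝ (convexHull ℝ (S : Set E))) = y :=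
      Subtype.ext (by simp [hy0])
    rw [hy'] at ht
    have hev := ((ht.eventually (mem_interior_iff_mem_nhds.1 hy)).filter_mono
      (nhdsWithin_le_nhds (s := Set.Ioi (0 : ℝ)))).and self_mem_nhdsWithin
    obtain ⟨s, hs, hs0⟩ := hev.exists
    have hs0' : (0 : ℝ) < s := hs0
    have hs' : -s • x ∈ convexHull ℝ (S : Set E) := hs
    obtain ⟨w, hw0, -, hwx⟩ := Finset.mem_convexHull'.1 hs'
    refine ⟨fun u => w u + if u = x then s else 0, fun u hu => ?_, ?_, ?_⟩
    · exact add_nonneg (hw0 u hu) (by split_ifs <;> linarith)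
    · simpa using add_pos_of_nonneg_of_pos (hw0 x hx) hs0'
    · simp only [add_smul, Finset.sum_add_distrib, hwx, ite_smul, zero_smul]
      rw [Finset.sum_ite_eq' S x, if_pos hx]
      simp
  choose! b hb0 hbx hbs using hb
  refine ⟨fun u => ∑ x ∈ S, b x u, fun u hu => ?_, ?_⟩
  · exact Finset.sum_pos' (fun x hx => hb0 x hx u hu) ⟨u, hu, hbx u hu⟩
  · simp only [Finset.sum_smul]
    rw [Finset.sum_comm]
    exact Finset.sum_eq_zero fun x hx => hbs x hx

/-- The coefficient map onto the span is open. Positive coefficients of sum below `1` give points of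
the hull, because the missing mass can be supplied by a multiple of `a` without moving the point. -/
theorem zero_mem_intrinsicInterior_of_pos_relation [FiniteDimensional ℝ E] {S : Finset E}
    (hS : S.Nonempty) {a : E → ℝ} (ha : ∀ u ∈ S, 0 < a u) (hsum : ∑ u ∈ S, a u • u = 0) :
    (0 : E) ∈ intrinsicInterior ℝ (convexHull ℝ (S : Set E)) := by
  classical
  set W := Submodule.span ℝ (S : Set E) with hW
  have hSW : ∀ x : S, (x : E) ∈ W := fun x => Submodule.subset_span x.2
  set T : (S → ℝ) →ₗ[ℝ] W :=
    Fintype.linearCombination ℝ (fun x : S => (⟨x, hSW x⟩ : W)) with hT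
  have hTw : ∀ w : S → ℝ, (T w : E) = ∑ x : S, w x • (x : E) := fun w => by
    simp [hT, Fintype.linearCombination_apply]
  have hTsurj : Function.Surjective T := by
    intro y
    obtain ⟨c, -, hc⟩ := Submodule.mem_span_finset.1 y.2
    refine ⟨fun x => c x, Subtype.ext ?_⟩
    rw [hTw, ← hc, Finset.sum_coe_sort S (fun x => c x • x)]
  set O : Set (S → ℝ) := {w | (∀ x, 0 < w x) ∧ ∑ x, w x < 1} with hO
  have hOopen : IsOpen O := by
    have h1 : IsOpen {w : S → ℝ | ∀ x, 0 < w x} := by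
      simp only [Set.ofPred_forall]
      exact isOpen_iInter_of_finite fun x => isOpen_lt continuous_const (by fun_prop)
    have h2 : IsOpen {w : S → ℝ | ∑ x, w x < 1} := isOpen_lt (by fun_prop) continuous_const
    exact h1.inter h2
  have hTO := LinearMap.isOpenMap_of_finiteDimensional T hTsurj O hOopen
  have hapos : 0 < ∑ u ∈ S, a u := Finset.sum_pos ha hS
  have hsub : ∀ w ∈ O, (T w : E) ∈ convexHull ℝ (S : Set E) := by
    intro w hw
    set r := (1 - ∑ x, w x) / ∑ u ∈ S, a u with hr
    have hr0 : 0 ≤ r := div_nonneg (sub_nonneg.2 hw.2.le) hapos.le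
    have heq : (T w : E) = ∑ x : S, (w x + r * a x) • (x : E) := by
      simp only [add_smul, Finset.sum_add_distrib, mul_smul, ← Finset.smul_sum]
      rw [Finset.sum_coe_sort S (fun x => a x • x), hsum, smul_zero, add_zero, hTw]
    rw [heq]
    refine (convex_convexHull ℝ _).sum_mem
      (fun x _ => add_nonneg (hw.1 x).le (mul_nonneg hr0 (ha x x.2).le)) ?_
      fun x _ => subset_convexHull ℝ _ x.2
    rw [Finset.sum_add_distrib, ← Finset.mul_sum, Finset.sum_coe_sort S a, hr,
      div_mul_cancel₀ _ hapos.ne', add_sub_cancel]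
  have hzero : (0 : W) ∈ T '' O := by
    set r := (2 * ∑ u ∈ S, a u)⁻¹ with hr
    have hr0 : 0 < r := inv_pos.2 (by positivity)
    refine ⟨fun x => r * a x, ⟨fun x => mul_pos hr0 (ha x x.2), ?_⟩, Subtype.ext ?_⟩
    · rw [← Finset.mul_sum, Finset.sum_coe_sort S a, hr, mul_inv, mul_assoc,
        inv_mul_cancel₀ hapos.ne']
      norm_num
    · rw [hTw]
      simp only [mul_smul, ← Finset.smul_sum]
      rw [Finset.sum_coe_sort S (fun x => a x • x), hsum, smul_zero, Submodule.coe_zero]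
  have h0 : (0 : E) ∈ convexHull ℝ (S : Set E) := by
    obtain ⟨w, hw, hw0⟩ := hzero
    have := hsub w hw
    rwa [hw0, Submodule.coe_zero] at this
  have haff : ∀ y ∈ affineSpan ℝ (convexHull ℝ (S : Set E)), y ∈ W := fun y hy => by
    rw [affineSpan_convexHull] at hy
    exact affineSpan_subset_span hy
  refine mem_intrinsicInterior.2
    ⟨⟨0, subset_affineSpan ℝ _ h0⟩, mem_interior.2 ⟨(fun y => (⟨y, haff y y.2⟩ : W)) ⁻¹' (T '' O),
      ?_, hTO.preimage (Continuous.subtype_mk continuous_subtype_val _), hzero⟩, rfl⟩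
  rintro y ⟨w, hw, hwy⟩
  have := hsub w hw
  rw [hwy] at this
  exact this

/-- Subtracting the multiple of `a` with the same coefficient sum leaves an affine relation, which
is trivial. -/
theorem AffineIndependent.exists_eq_mul_of_relation {S : Finset E}
    (h : AffineIndependent ℝ (fun u : S => (u : E))) {a c : E → ℝ} (ha : ∀ u ∈ S, 0 < a u)
    (ha0 : ∑ u ∈ S, a u • u = 0) (hc0 : ∑ u ∈ S, c u • u = 0) :
    ∃ s : ℝ, ∀ u ∈ S, c u = s * a u := by
  rcases S.eq_empty_or_nonempty with rfl | hS
  · exact ⟨0, by simp⟩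
  have hapos : 0 < ∑ u ∈ S, a u := Finset.sum_pos ha hS
  set s := (∑ u ∈ S, c u) / ∑ u ∈ S, a u with hs
  refine ⟨s, fun u hu => sub_eq_zero.1 ?_⟩
  refine (affineIndependent_iff.1 h) Finset.univ (fun u => c u - s * a u) ?_ ?_ ⟨u, hu⟩
    (Finset.mem_univ _)
  · rw [Finset.sum_coe_sort S (fun u => c u - s * a u), Finset.sum_sub_distrib, ← Finset.mul_sum,
      hs, div_mul_cancel₀ _ hapos.ne', sub_self]
  · rw [Finset.sum_coe_sort S (fun u => (c u - s * a u) • u)]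
    simp only [sub_smul, mul_smul, Finset.sum_sub_distrib, ← Finset.smul_sum, ha0, hc0]
    simp

end Simplex

/-! ### Skeletons as spanning block families -/

section Skeleton

variable {n : ℕ} {P : Set (EuclideanSpace ℝ (Fin n))}

/-- The label of `u` is the set of all `i` with `u ∈ X i`: a singleton on the skeleton, and defined
everywhere even when `Fin k` is empty. -/
theorem IsSkeleton.exists_isBlockFamily {k : ℕ} {X : Fin k → Finset (EuclideanSpace ℝ (Fin n))}
    [DecidableEq (EuclideanSpace ℝ (Fin n))] (hX : IsSkeleton P X) :
    ∃ (p : EuclideanSpace ℝ (Fin n) → Set (Fin k)) (α : EuclideanSpace ℝ (Fin n) → ℝ),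
      IsBlockFamily (Finset.univ.biUnion X) p α ∧ ∀ i, ∀ u ∈ X i, p u = {i} := by
  classical
  choose a ha hsum using fun i => exists_pos_relation_of_zero_mem_intrinsicInterior (hX.zero_mem i)
  have huniq : ∀ i j, ∀ u ∈ X i, u ∈ X j → j = i := fun i j u hi hj => by
    by_contra hne
    exact Finset.disjoint_left.1 (hX.disjoint j i hne) hj hi
  have hp : ∀ i, ∀ u ∈ X i, {j | u ∈ X j} = ({i} : Set (Fin k)) := fun i u hu =>
    Set.eq_singleton_iff_unique_mem.2 ⟨hu, fun j hj => huniq i j u hu hj⟩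
  have hα : ∀ i, ∀ u ∈ X i, (∑ j, if u ∈ X j then a j u else 0) = a i u := fun i u hu => by
    rw [Finset.sum_eq_single i (fun j _ hj => if_neg fun h => hj (huniq i j u hu h))
      fun h => absurd (Finset.mem_univ i) h, if_pos hu]
  have hpd : ((Finset.univ : Finset (Fin k)) : Set (Fin k)).PairwiseDisjoint X :=
    fun i _ j _ hij => hX.disjoint i j hij
  refine ⟨fun u => {j | u ∈ X j}, fun u => ∑ j, if u ∈ X j then a j u else 0, ⟨?_, ?_, ?_⟩, hp⟩
  · intro u hu
    obtain ⟨i, -, hi⟩ := Finset.mem_biUnion.1 hu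
    rw [hα i u hi]
    exact ha i u hi
  · intro t
    rw [Finset.sum_biUnion hpd]
    refine Finset.sum_eq_zero fun i _ => ?_
    rw [Finset.sum_congr rfl fun u hu => by rw [hp i u hu, hα i u hu, mul_smul],
      ← Finset.smul_sum, hsum, smul_zero]
  · intro c hc
    have hcs := hc.sum_eq
    simp only [id] at hcs
    rw [Finset.sum_biUnion hpd] at hcs
    have hz := (iSupIndep_iff_finsetSum_eq_zero_imp_eq_zero _).1 hX.independent Finset.univ
      (fun i => ∑ u ∈ X i, c u • u) (fun i _ => Submodule.sum_mem _ fun u hu =>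
        Submodule.smul_mem _ _ (Submodule.subset_span hu)) hcs
    choose s hs using fun i => (hX.simplex i).exists_eq_mul_of_relation (ha i) (hsum i)
      (hz i (Finset.mem_univ i))
    refine ⟨fun K => ∑ i, if i ∈ K then s i else 0, fun u hu => ?_⟩
    obtain ⟨i, -, hi⟩ := Finset.mem_biUnion.1 hu
    rw [hp i u hi, hα i u hi, hs i u hi]
    simp

/-- The fibres of `p` are the simplices. Affine independence and independence of spans both follow
because every relation is constant times `α` on each fibre. -/
theorem IsBlockFamily.exists_isSkeleton {U : Finset (EuclideanSpace ℝ (Fin n))}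
    {κ : Type*} {p : EuclideanSpace ℝ (Fin n) → κ} {α : EuclideanSpace ℝ (Fin n) → ℝ}
    (hU : IsBlockFamily U p α) (hUP : ∀ u ∈ U, u ∈ facetNormals P)
    (hspan : Submodule.span ℝ (U : Set (EuclideanSpace ℝ (Fin n))) = ⊤) :
    ∃ (k : ℕ) (X : Fin k → Finset (EuclideanSpace ℝ (Fin n))), IsSkeleton P X := by
  classical
  set e := (U.image p).equivFin.symm with he
  set X : Fin (U.image p).card → Finset (EuclideanSpace ℝ (Fin n)) :=
    fun i => U.filter (fun u => p u = e i) with hX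
  have hXU : ∀ i, X i ⊆ U := fun i => Finset.filter_subset _ _
  have hXp : ∀ i, ∀ u ∈ X i, p u = e i := fun i u hu => (Finset.mem_filter.1 hu).2
  have huniq : ∀ i j, ∀ u ∈ X i, u ∈ X j → i = j := fun i j u hi hj =>
    e.injective (Subtype.ext ((hXp i u hi).symm.trans (hXp j u hj)))
  have hsum : ∀ i, ∑ u ∈ X i, α u • u = 0 := fun i => by
    rw [← hU.sum_eq fun κ => if κ = e i then 1 else 0, Finset.sum_filter]
    refine Finset.sum_congr rfl fun u _ => ?_
    split_ifs <;> simp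
  have hne : ∀ i, (X i).Nonempty := fun i => by
    obtain ⟨u, hu, hpu⟩ := Finset.mem_image.1 (e i).2
    exact ⟨u, Finset.mem_filter.2 ⟨hu, hpu⟩⟩
  have hpos : ∀ i, ∀ u ∈ X i, 0 < α u := fun i u hu => hU.pos u (hXU i hu)
  refine ⟨_, X, ⟨fun i u hu => hUP u (hXU i hu), fun i j hij => Finset.disjoint_left.2
    fun u hi hj => hij (huniq i j u hi hj), fun i => ?_, fun i =>
      zero_mem_intrinsicInterior_of_pos_relation (hne i) (hpos i) (hsum i), ?_, ?_⟩⟩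
  · rw [affineIndependent_iff_of_fintype]
    intro w hw0 hw
    rw [Finset.univ.weightedVSub_eq_linear_combination hw0] at hw
    obtain ⟨t, ht⟩ := hU.exists_eq (fun u => if h : u ∈ X i then w ⟨u, h⟩ else 0)
      ⟨fun u hu => dif_neg fun h => hu (hXU i h), by
        rw [← Finset.sum_subset (hXU i) fun u _ hu => by simp [hu], ← hw, ← Finset.sum_coe_sort]
        simp⟩
    have ht' : ∀ u : X i, w u = t (e i) * α u := fun u => by
      have := ht u (hXU i u.2)
      rw [dif_pos u.2, hXp i u u.2] at this
      exact this
    have h0 : t (e i) = 0 := by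
      simp only [ht', ← Finset.mul_sum] at hw0
      rw [Finset.sum_coe_sort (X i) α] at hw0
      exact (mul_eq_zero.1 hw0).resolve_right (Finset.sum_pos (hpos i) (hne i)).ne'
    intro u
    rw [ht', h0, zero_mul]
  · rw [iSupIndep_iff_finsetSum_eq_zero_imp_eq_zero]
    intro s v hv hv0 i hi
    have hc : ∀ j, ∃ c : EuclideanSpace ℝ (Fin n) → ℝ, j ∈ s → ∑ u ∈ X j, c u • u = v j := by
      intro j
      by_cases hj : j ∈ s
      · obtain ⟨c, -, hc⟩ := Submodule.mem_span_finset.1 (hv j hj)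
        exact ⟨c, fun _ => hc⟩
      · exact ⟨0, fun h => absurd h hj⟩
    choose c hc using hc
    obtain ⟨t, ht⟩ := hU.exists_eq (fun u => ∑ j ∈ s, if u ∈ X j then c j u else 0)
      ⟨fun u hu => Finset.sum_eq_zero fun j _ => if_neg fun h => hu (hXU j h), by
        simp only [Finset.sum_smul, id]
        rw [Finset.sum_comm, ← hv0]
        refine Finset.sum_congr rfl fun j hj => ?_
        rw [← hc j hj, ← Finset.sum_subset (hXU j) fun u _ hu => by simp [hu]]
        exact Finset.sum_congr rfl fun u hu => by rw [if_pos hu]⟩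
    rw [← hc i hi]
    have hci : ∀ u ∈ X i, c i u • u = t (e i) • α u • u := fun u hu => by
      have h1 := ht u (hXU i hu)
      rw [Finset.sum_eq_single i (fun j _ hj => if_neg fun h => hj (huniq j i u h hu))
        fun h => absurd hi h, if_pos hu, hXp i u hu] at h1
      rw [h1, mul_smul]
    rw [Finset.sum_congr rfl hci, ← Finset.smul_sum, hsum, smul_zero]
  · rw [eq_top_iff, ← hspan, Submodule.span_le]
    intro u hu
    have hmem : u ∈ X (e.symm ⟨p u, Finset.mem_image_of_mem p hu⟩) :=
      Finset.mem_filter.2 ⟨hu, by simp⟩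
    exact Submodule.mem_iSup_of_mem _ (Submodule.subset_span hmem)

theorem IsStronglyMonotypic.exists_isSkeleton (hP : IsStronglyMonotypic P) :
    ∃ (k : ℕ) (X : Fin k → Finset (EuclideanSpace ℝ (Fin n))), IsSkeleton P X := by
  have hN : ((finite_facetNormals hP.1).toFinset : Set (EuclideanSpace ℝ (Fin n))) =
    facetNormals P := Set.Finite.coe_toFinset _
  obtain ⟨U, p, α, hU, hUN, hspan⟩ := exists_isBlockFamily_span_eq_top
    (N := (finite_facetNormals hP.1).toFinset)
    (fun d hd => eq_zero_of_forall_inner_nonpos hP.1 fun u hu =>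
      hd u ((finite_facetNormals hP.1).mem_toFinset.2 hu))
    (fun c hc => hP.circuit_signs hN hc)
  exact hU.exists_isSkeleton
    (fun u hu => (finite_facetNormals hP.1).mem_toFinset.1 (hUN hu)) hspan

end Skeleton

/-! ### Illumination and covering -/

section Illumination

variable {n : ℕ} {P : Set (EuclideanSpace ℝ (Fin n))}

/-- If the sum of the normals active at `x` is a nonnegative combination of normals with
coefficients `γ`, then every normal active at `x` is a nonnegative combination of the normals
occurring in `γ`. -/
theorem IsStronglyMonotypic.active_mem_cone (hP : IsStronglyMonotypic P)
    [DecidableEq (EuclideanSpace ℝ (Fin n))] {N F : Finset (EuclideanSpace ℝ (Fin n))}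
    (hN : (N : Set (EuclideanSpace ℝ (Fin n))) = facetNormals P)
    {x : EuclideanSpace ℝ (Fin n)} (hx : x ∈ P) (hFN : F ⊆ N)
    (hF : ∀ u ∈ N, u ∈ F ↔ inner ℝ u x = supportFn P u) {γ : EuclideanSpace ℝ (Fin n) → ℝ}
    (hγN : ∀ u, u ∉ N → γ u = 0) (hγ0 : ∀ u, 0 ≤ γ u) (hγ : ∑ u ∈ N, γ u • u = ∑ u ∈ F, u)
    {u₀ : EuclideanSpace ℝ (Fin n)} (hu₀ : u₀ ∈ F) :
    ∃ δ : EuclideanSpace ℝ (Fin n) → ℝ, (∀ u, 0 ≤ δ u) ∧ (∀ u, δ u ≠ 0 → γ u ≠ 0) ∧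
      ∑ u ∈ N, δ u • u = u₀ := by
  by_cases hγu : γ u₀ = 0
  swap
  · refine ⟨fun u => if u = u₀ then 1 else 0, fun u => by positivity, fun u hu => ?_, ?_⟩
    · have : u = u₀ := by
        by_contra h
        exact hu (if_neg h)
      rwa [this]
    · simp [hFN hu₀]
  have hmemP : ∀ u ∈ N, u ∈ facetNormals P := fun u hu => hN ▸ Finset.mem_coe.2 hu
  have hc : IsRelation id N (fun u => (if u ∈ F then 1 else 0) - γ u) := by
    refine ⟨fun u hu => ?_, ?_⟩
    · rw [if_neg fun h => hu (hFN h), hγN u hu, sub_zero]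
    · simp only [id, sub_smul, Finset.sum_sub_distrib, hγ, ite_smul, one_smul, zero_smul]
      rw [← Finset.sum_filter, Finset.filter_mem_eq_inter, Finset.inter_eq_right.2 hFN, sub_self]
  -- Positive coefficients of `d` sit on active normals, negative ones on the support of `γ`. If
  -- `u₀` is the only positive one, solving for `u₀` gives `δ`.
  obtain ⟨d, hd, hdc, hdu₀⟩ := hc.exists_conformal_circuit (e := u₀) (by simp [hu₀, hγu])
  have hdF : ∀ u, 0 < d u → u ∈ F := fun u hu => by
    by_contra h
    have := (hdc u).1 hu
    dsimp only at this
    rw [if_neg h] at this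
    linarith [hγ0 u]
  have hdγ : ∀ u, d u < 0 → γ u ≠ 0 := fun u hu h => by
    have := (hdc u).2 hu
    dsimp only at this
    rw [h, sub_zero] at this
    split_ifs at this <;> linarith
  have hdpos : 0 < d u₀ := by
    rcases lt_or_gt_of_ne hdu₀ with h | h
    · exact absurd hγu (hdγ u₀ h)
    · exact h
  rcases hP.circuit_signs hN hd with h | h
  · have hle : ∀ u, u ≠ u₀ → d u ≤ 0 := fun u hu =>
      not_lt.1 fun hpos => hu (h u u₀ hpos hdpos)
    refine ⟨fun u => if u = u₀ then 0 else -d u / d u₀, fun u => ?_, fun u hu => ?_, ?_⟩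
    · dsimp only
      split_ifs with huu
      · exact le_rfl
      · exact div_nonneg (neg_nonneg.2 (hle u huu)) hdpos.le
    · dsimp only at hu
      split_ifs at hu with huu
      · exact absurd rfl hu
      · refine hdγ u (lt_of_le_of_ne (hle u huu) fun h0 => hu ?_)
        rw [h0, neg_zero, zero_div]
    · have hs := hd.sum_eq
      simp only [id] at hs
      rw [← Finset.add_sum_erase _ _ (hFN hu₀)] at hs ⊢
      have h1 : ∀ u ∈ N.erase u₀, (if u = u₀ then 0 else -d u / d u₀) • u =
          (-(d u₀)⁻¹) • d u • u := fun u hu => by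
        rw [if_neg (Finset.ne_of_mem_erase hu), smul_smul]
        congr 1
        ring
      rw [Finset.sum_congr rfl h1, ← Finset.smul_sum, eq_neg_of_add_eq_zero_right hs]
      simp [smul_smul, hdu₀]
  · exfalso
    refine hdu₀ (hP.active_independent hN hd.toIsRelation (x := x) (fun b hb => ?_) u₀)
    rcases lt_or_gt_of_ne hb with hbneg | hbpos
    · have hbN := hd.mem hb
      -- Here `b` is the only negative coefficient. Comparing `x` with a point `q` of the facet of
      -- `b` gives nonpositive terms of sum zero, so `b` is active at `x` too. All of `d` is then
      -- active, contrary to independence.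
      obtain ⟨q, hq, hbq⟩ := exists_mem_faceIn_inner_eq (hmemP b hbN)
      have hterm : ∀ u ∈ N, d u * (inner ℝ u q - inner ℝ u x) ≤ 0 := by
        intro u hu
        rcases lt_trichotomy (d u) 0 with hu0 | hu0 | hu0
        · rw [h u b hu0 hbneg, hbq]
          exact mul_nonpos_of_nonpos_of_nonneg hbneg.le
            (sub_nonneg.2 (inner_le_supportFn hP.1.isCompact b hx))
        · simp [hu0]
        · rw [(hF u hu).1 (hdF u hu0)]
          exact mul_nonpos_of_nonneg_of_nonpos hu0.le
            (sub_nonpos.2 (inner_le_supportFn hP.1.isCompact u hq))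
      have hsum : ∑ u ∈ N, d u * (inner ℝ u q - inner ℝ u x) = 0 := by
        simp only [mul_sub, Finset.sum_sub_distrib, hd.sum_inner, sub_self]
      have hb0 := (Finset.sum_eq_zero_iff_of_nonpos hterm).1 hsum b hbN
      rw [← hbq]
      exact (sub_eq_zero.1 ((mul_eq_zero.1 hb0).resolve_left hb)).symm
    · exact (hF b (hd.mem hb)).1 (hdF b hbpos)

theorem IsSkeleton.nonempty {k : ℕ} {X : Fin k → Finset (EuclideanSpace ℝ (Fin n))}
    (hX : IsSkeleton P X) (i : Fin k) : (X i).Nonempty := by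
  have := convexHull_nonempty_iff.1 ⟨0, intrinsicInterior_subset (hX.zero_mem i)⟩
  exact this

/-- The union of the sets of a skeleton, with one vector of each set omitted, is independent. -/
theorem IsSkeleton.relation_eq_zero [DecidableEq (EuclideanSpace ℝ (Fin n))] {k : ℕ}
    {X : Fin k → Finset (EuclideanSpace ℝ (Fin n))} (hX : IsSkeleton P X)
    {T : Fin k → EuclideanSpace ℝ (Fin n)} (hT : ∀ i, T i ∈ X i)
    {c : EuclideanSpace ℝ (Fin n) → ℝ}
    (hc : IsRelation id (Finset.univ.biUnion fun i => (X i).erase (T i)) c)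
    (u : EuclideanSpace ℝ (Fin n)) : c u = 0 := by
  obtain ⟨p, α, hU, hp⟩ := hX.exists_isBlockFamily
  refine hU.eq_zero_of_relation (hc.mono (Finset.biUnion_mono fun i _ => Finset.erase_subset _ _))
    (fun w hw => ?_) u
  obtain ⟨i, -, hi⟩ := Finset.mem_biUnion.1 hw
  refine ⟨T i, Finset.mem_biUnion.2 ⟨i, Finset.mem_univ i, hT i⟩, ?_, hc.supp _ fun hmem => ?_⟩
  · rw [hp i w hi, hp i _ (hT i)]
  · obtain ⟨j, -, hj⟩ := Finset.mem_biUnion.1 hmem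
    rw [Finset.mem_erase] at hj
    by_cases hij : i = j
    · subst hij
      exact hj.1 rfl
    · exact Finset.disjoint_left.1 (hX.disjoint i j hij) (hT i) hj.2

/-- Omitting one vector of each set leaves an independent family, so the numbers `|X i| - 1` add up
to at most `n`; and `m ≤ 2 ^ (m - 1)` for `m ≥ 1`. -/
theorem IsSkeleton.prod_card_le {k : ℕ} {X : Fin k → Finset (EuclideanSpace ℝ (Fin n))}
    (hX : IsSkeleton P X) : ∏ i, (X i).card ≤ 2 ^ n := by
  classical
  choose T hT using hX.nonempty
  have hli := linearIndependent_of_relation_eq_zero fun c hc u => hX.relation_eq_zero hT hc u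
  have hcard := hli.fintype_card_le_finrank
  rw [Fintype.card_coe, finrank_euclideanSpace_fin, Finset.card_biUnion fun i _ j _ hij =>
    Finset.disjoint_of_subset_left (Finset.erase_subset _ _)
      (Finset.disjoint_of_subset_right (Finset.erase_subset _ _) (hX.disjoint i j hij))] at hcard
  calc ∏ i, (X i).card ≤ ∏ i, 2 ^ ((X i).erase (T i)).card := by
        refine Finset.prod_le_prod' fun i _ => ?_
        rw [← Finset.card_erase_add_one (hT i)]
        exact Nat.lt_two_pow_self
    _ = 2 ^ ∑ i, ((X i).erase (T i)).card := Finset.prod_pow_eq_pow_sum _ _ _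
    _ ≤ 2 ^ n := Nat.pow_le_pow_right two_pos hcard

/-- A direction for every choice of one vector of each set of the skeleton, such that at every
point of `P` one of the directions points out of all active facets. -/
theorem IsStronglyMonotypic.exists_directions (hP : IsStronglyMonotypic P) {k : ℕ}
    {X : Fin k → Finset (EuclideanSpace ℝ (Fin n))} (hX : IsSkeleton P X) :
    ∃ v : (Fin k → EuclideanSpace ℝ (Fin n)) → EuclideanSpace ℝ (Fin n),
      ∀ x ∈ P, ∃ T ∈ Fintype.piFinset X, ∀ u ∈ facetNormals P,
        inner ℝ u x = supportFn P u → 0 < inner ℝ u (v T) := by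
  classical
  have hv : ∀ T : Fin k → EuclideanSpace ℝ (Fin n), ∃ v : EuclideanSpace ℝ (Fin n),
      (∀ i, T i ∈ X i) → ∀ u ∈ Finset.univ.biUnion fun i => (X i).erase (T i), inner ℝ u v = 1 := by
    intro T
    by_cases hT : ∀ i, T i ∈ X i
    · obtain ⟨v, hv⟩ := exists_inner_eq_of_relation_eq_zero
        (fun c hc u => hX.relation_eq_zero hT hc u) (fun _ => (1 : ℝ))
      exact ⟨v, fun _ => hv⟩
    · exact ⟨0, fun h => absurd h hT⟩
  choose v hv using hv
  refine ⟨v, fun x hx => ?_⟩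
  obtain ⟨p, α, hU, hp⟩ := hX.exists_isBlockFamily
  set U := Finset.univ.biUnion X
  have hfin := finite_facetNormals hP.1
  have hN : (hfin.toFinset : Set (EuclideanSpace ℝ (Fin n))) = facetNormals P := hfin.coe_toFinset
  set N := hfin.toFinset
  have hUN : U ⊆ N := fun u hu => by
    obtain ⟨i, -, hi⟩ := Finset.mem_biUnion.1 hu
    exact hfin.mem_toFinset.2 (hX.subset_normals i u hi)
  have hspan : Submodule.span ℝ (U : Set (EuclideanSpace ℝ (Fin n))) = ⊤ := by
    rw [eq_top_iff, ← hX.span_eq_top, iSup_le_iff]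
    exact fun i => Submodule.span_mono fun u hu =>
      Finset.mem_biUnion.2 ⟨i, Finset.mem_univ i, hu⟩
  set F := N.filter (fun u => inner ℝ u x = supportFn P u)
  -- The choice `T` for `x` consists of vectors that this combination of the active normals' sum
  -- omits.
  obtain ⟨γ, hγU, hγ0, hγs, hγz⟩ := hU.exists_nonneg_combination (l := ∑ u ∈ F, u)
    (hspan ▸ Submodule.mem_top)
  have hT : ∀ i, ∃ w ∈ X i, γ w = 0 := by
    intro i
    obtain ⟨u, hu⟩ := hX.nonempty i
    obtain ⟨w, hw, hpw, hγw⟩ := hγz u (Finset.mem_biUnion.2 ⟨i, Finset.mem_univ i, hu⟩)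
    obtain ⟨j, -, hj⟩ := Finset.mem_biUnion.1 hw
    rw [hp i u hu, hp j w hj, Set.singleton_eq_singleton_iff] at hpw
    exact ⟨w, hpw ▸ hj, hγw⟩
  choose T hTX hTγ using hT
  refine ⟨T, Fintype.mem_piFinset.2 hTX, fun u hu hux => ?_⟩
  have huF : u ∈ F := Finset.mem_filter.2 ⟨hfin.mem_toFinset.2 hu, hux⟩
  obtain ⟨δ, hδ0, hδγ, hδs⟩ := hP.active_mem_cone hN hx (Finset.filter_subset _ _)
    (fun w hw => by simp [hw]) (fun w hw => hγU w fun h => hw (hUN h)) hγ0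
    ((Finset.sum_subset hUN fun w _ hw => by rw [hγU w hw, zero_smul]).symm.trans hγs) huF
  have hone : ∀ w, δ w ≠ 0 → inner ℝ w (v T) = 1 := fun w hw => by
    have hwU : w ∈ U := by
      by_contra h
      exact hδγ w hw (hγU w h)
    obtain ⟨i, -, hi⟩ := Finset.mem_biUnion.1 hwU
    refine hv T hTX w (Finset.mem_biUnion.2 ⟨i, Finset.mem_univ i, Finset.mem_erase.2 ⟨?_, hi⟩⟩)
    rintro rfl
    exact hδγ _ hw (hTγ i)
  have hinner : inner ℝ u (v T) = ∑ w ∈ N, δ w := by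
    rw [← hδs, sum_inner]
    refine Finset.sum_congr rfl fun w _ => ?_
    rw [real_inner_smul_left]
    by_cases hw : δ w = 0
    · simp [hw]
    · rw [hone w hw, mul_one]
  rw [hinner]
  refine lt_of_le_of_ne (Finset.sum_nonneg fun w _ => hδ0 w) fun h0 => ?_
  have hz := (Finset.sum_eq_zero_iff_of_nonneg fun w _ => hδ0 w).1 h0.symm
  rw [Finset.sum_eq_zero fun w hw => by rw [hz w hw, zero_smul]] at hδs
  exact ne_zero_of_mem_facetNormals hu hδs.symm

theorem eventually_sub_smul_mem_interior (hP : IsFullPolytope P) {x v : EuclideanSpace ℝ (Fin n)}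
    (hx : x ∈ P) (hv : ∀ u ∈ facetNormals P, inner ℝ u x = supportFn P u → 0 < inner ℝ u v) :
    ∀ᶠ t : ℝ in nhdsWithin 0 (Set.Ioi 0), x - t • v ∈ interior P := by
  have : ∀ u ∈ facetNormals P, ∀ᶠ t : ℝ in nhdsWithin 0 (Set.Ioi 0),
      inner ℝ u (x - t • v) < supportFn P u := by
    intro u hu
    by_cases hux : inner ℝ u x = supportFn P u
    · filter_upwards [self_mem_nhdsWithin] with t ht
      rw [inner_sub_right, real_inner_smul_right, hux]
      have := mul_pos (Set.mem_Ioi.1 ht) (hv u hu hux)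
      linarith
    · have hlt := lt_of_le_of_ne (inner_le_supportFn hP.isCompact u hx) hux
      have hcont : Continuous (fun t : ℝ => inner ℝ u (x - t • v)) := by fun_prop
      have ht := hcont.tendsto 0
      simp only [zero_smul, sub_zero] at ht
      exact (ht.mono_left nhdsWithin_le_nhds).eventually (gt_mem_nhds hlt)
  filter_upwards [(Filter.eventually_all_finite (finite_facetNormals hP)).2 this] with t ht
  exact (mem_interior_iff_forall_facetNormals hP).2 ht

/-- Pointwise illumination by finitely many directions is achieved by a common scaling. -/
theorem exists_uniform_scaling {ι : Type*} (hconv : Convex ℝ P) (hcpt : IsCompact P) {S : Finset ι}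
    {v : ι → EuclideanSpace ℝ (Fin n)}
    (h : ∀ x ∈ P, ∃ T ∈ S, ∀ᶠ t : ℝ in nhdsWithin 0 (Set.Ioi 0), x - t • v T ∈ interior P) :
    ∃ t : ℝ, ∀ x ∈ P, ∃ T ∈ S, x - t • v T ∈ interior P := by
  have hind : ∀ᶠ t : ℝ in nhdsWithin 0 (Set.Ioi 0), ∀ x ∈ P, x ∈ P →
      ∃ T ∈ S, x - t • v T ∈ interior P := by
    refine hcpt.induction_on (p := fun s => ∀ᶠ t : ℝ in nhdsWithin 0 (Set.Ioi 0), ∀ x ∈ s, x ∈ P →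
      ∃ T ∈ S, x - t • v T ∈ interior P) (by simp)
      (fun s s' hss h => h.mono fun t ht x hx => ht x (hss hx))
      (fun s s' hs hs' => (hs.and hs').mono fun t ht x hx => hx.elim (ht.1 x) (ht.2 x))
      fun x hx => ?_
    obtain ⟨T, hT, hev⟩ := h x hx
    obtain ⟨t₁, ht₁, ht₁0⟩ := (hev.and self_mem_nhdsWithin).exists
    have ht₁0' : (0 : ℝ) < t₁ := ht₁0
    have hcont : Continuous (fun y : EuclideanSpace ℝ (Fin n) => y - t₁ • v T) := by fun_prop
    refine ⟨_, mem_nhdsWithin_of_mem_nhds ((isOpen_interior.preimage hcont).mem_nhds ht₁), ?_⟩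
    filter_upwards [Ioc_mem_nhdsGT ht₁0'] with t ht y hy hyP
    refine ⟨T, hT, ?_⟩
    -- If `t₁` works at `y`, every smaller positive `t` does: `y - t • v T` is a convex combination
    -- of `y ∈ P` and the interior point `y - t₁ • v T`.
    have hcombo := hconv.combo_self_interior_mem_interior (a := 1 - t / t₁) (b := t / t₁) hyP hy
      (sub_nonneg.2 ((div_le_one ht₁0').2 ht.2)) (div_pos ht.1 ht₁0') (by ring)
    convert hcombo using 1
    have : t • v T = (t / t₁) • t₁ • v T := by
      rw [smul_smul, div_mul_cancel₀ _ ht₁0'.ne']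
    rw [this]
    module
  obtain ⟨t, ht⟩ := hind.exists
  exact ⟨t, fun x hx => ht x hx hx⟩

/-- Since `x - v` is interior, dividing it by `1 - δ` with small `δ` keeps it in `P`; compactness
makes `δ` uniform. -/
theorem satisfiesHadwiger_of_cover (hcpt : IsCompact P)
    {V : Finset (EuclideanSpace ℝ (Fin n))} (hV : V.card ≤ 2 ^ n)
    (h : ∀ x ∈ P, ∃ v ∈ V, x - v ∈ interior P) : SatisfiesHadwiger P := by
  have hind : ∀ᶠ δ : ℝ in nhdsWithin 0 (Set.Ioi 0), ∀ x ∈ P,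
      ∃ v ∈ V, (1 - δ)⁻¹ • (x - v) ∈ interior P := by
    refine hcpt.induction_on (p := fun s => ∀ᶠ δ : ℝ in nhdsWithin 0 (Set.Ioi 0), ∀ x ∈ s,
      ∃ v ∈ V, (1 - δ)⁻¹ • (x - v) ∈ interior P) (by simp)
      (fun s s' hss h => h.mono fun t ht x hx => ht x (hss hx))
      (fun s s' hs hs' => (hs.and hs').mono fun t ht x hx => hx.elim (ht.1 x) (ht.2 x))
      fun x hx => ?_
    obtain ⟨v, hv, hxv⟩ := h x hx
    have hcont : ContinuousAt (fun z : ℝ × EuclideanSpace ℝ (Fin n) =>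
        (1 - z.1)⁻¹ • (z.2 - v)) (0, x) := by
      have h1 : ContinuousAt (fun z : ℝ × EuclideanSpace ℝ (Fin n) => 1 - z.1) (0, x) := by
        fun_prop
      exact (h1.inv₀ (by simp)).smul (by fun_prop)
    have hev := hcont.eventually (isOpen_interior.mem_nhds (by simpa using hxv))
    rw [nhds_prod_eq, Filter.eventually_prod_iff] at hev
    obtain ⟨pa, hpa, pb, hpb, hpab⟩ := hev
    refine ⟨{y | pb y}, mem_nhdsWithin_of_mem_nhds hpb, ?_⟩
    filter_upwards [hpa.filter_mono nhdsWithin_le_nhds] with δ hδ y hy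
    exact ⟨v, hv, hpab hδ hy⟩
  obtain ⟨δ, hδ, hδ01⟩ := (hind.and (Ioo_mem_nhdsGT one_pos)).exists
  refine ⟨δ, hδ01.1, hδ01.2, V, hV, fun x hx => ?_⟩
  obtain ⟨v, hv, hxv⟩ := hδ x hx
  refine ⟨v, hv, _, interior_subset hxv, ?_⟩
  rw [smul_smul, mul_inv_cancel₀ (sub_pos.2 hδ01.2).ne', one_smul, add_sub_cancel]

/-- All points of `P`, not only boundary points, are treated, as the covering statement requires.
Different choices may give the same vector, so the set is padded to the exact cardinality. -/
theorem IsStronglyMonotypic.exists_cover (hP : IsStronglyMonotypic P) {k : ℕ}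
    {X : Fin k → Finset (EuclideanSpace ℝ (Fin n))} (hX : IsSkeleton P X) :
    ∃ V : Finset (EuclideanSpace ℝ (Fin n)), V.card = ∏ i, (X i).card ∧
      ∀ x ∈ P, ∃ v ∈ V, x - v ∈ interior P := by
  classical
  obtain ⟨v, hv⟩ := hP.exists_directions hX
  obtain ⟨t, ht⟩ := exists_uniform_scaling hP.1.convex hP.1.isCompact (S := Fintype.piFinset X)
    (v := v) fun x hx => by
      obtain ⟨T, hT, hTv⟩ := hv x hx
      exact ⟨T, hT, eventually_sub_smul_mem_interior hP.1 hx hTv⟩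
  set V := (Fintype.piFinset X).image (fun T => t • v T)
  have hcover : ∀ x ∈ P, ∃ w ∈ V, x - w ∈ interior P := fun x hx => by
    obtain ⟨T, hT, h⟩ := ht x hx
    exact ⟨_, Finset.mem_image_of_mem _ hT, h⟩
  have hcard : V.card ≤ ∏ i, (X i).card := Finset.card_image_le.trans_eq (Fintype.card_piFinset X)
  rcases subsingleton_or_nontrivial (EuclideanSpace ℝ (Fin n)) with hsub | hnt
  -- In dimension `0` there is nothing to pad with, but the product is empty and the set has exactly
  -- one element.
  · have hempty : IsEmpty (Fin k) := ⟨fun i => by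
      obtain ⟨u, hu⟩ := hX.nonempty i
      exact ne_zero_of_mem_facetNormals (hX.subset_normals i u hu) (Subsingleton.elim _ _)⟩
    refine ⟨V, le_antisymm hcard ?_, hcover⟩
    obtain ⟨p, hp⟩ := hP.1.2
    obtain ⟨w, hw, -⟩ := hcover p (interior_subset hp)
    simpa using Finset.card_pos.2 ⟨w, hw⟩
  · have hinf : Infinite (EuclideanSpace ℝ (Fin n)) := Module.Free.infinite ℝ _
    obtain ⟨V', hVV', hcard'⟩ := Infinite.exists_superset_card_eq V _ hcard
    refine ⟨V', hcard', fun x hx => ?_⟩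
    obtain ⟨w, hw, h⟩ := hcover x hx
    exact ⟨w, hVV' hw, h⟩

end Illumination

theorem theorem3 (n : ℕ) (P : Set (EuclideanSpace ℝ (Fin n))) (hP : IsStronglyMonotypic P) :
    (∃ (k : ℕ) (X : Fin k → Finset (EuclideanSpace ℝ (Fin n))), IsSkeleton P X) ∧
    (∀ (k : ℕ) (X : Fin k → Finset (EuclideanSpace ℝ (Fin n))), IsSkeleton P X →
      (∃ V : Finset (EuclideanSpace ℝ (Fin n)),
        V.card = ∏ i, (X i).card ∧ Illuminates V P) ∧
      ∏ i, (X i).card ≤ 2 ^ n) ∧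
    SatisfiesBoltyanski P ∧ SatisfiesHadwiger P := by
  have hfr : frontier P ⊆ P := hP.1.isCompact.isClosed.frontier_subset
  obtain ⟨k, X, hX⟩ := hP.exists_isSkeleton
  obtain ⟨V, hcard, hcover⟩ := hP.exists_cover hX
  have hV : V.card ≤ 2 ^ n := hcard ▸ hX.prod_card_le
  refine ⟨⟨k, X, hX⟩, fun k' X' hX' => ⟨?_, hX'.prod_card_le⟩,
    ⟨V, hV, fun x hx => hcover x (hfr hx)⟩,
    satisfiesHadwiger_of_cover hP.1.isCompact hV hcover⟩
  obtain ⟨V', hcard', hcover'⟩ := hP.exists_cover hX'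
  exact ⟨V', hcard', fun x hx => hcover' x (hfr hx)⟩
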